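/- Let $E=(E^0,E^1,r,s)$ be a directed graph with at least one edge, let $\mathbb{K}$ be a field, and let $\mathbb{F}$ be the free group on $E^1$. Let $L_{\mathbb{K}}(E)$ be the Leavitt path algebra of $E$, that is, the (not necessarily unital) associative $\mathbb{K}$-algebra generated by pairwise orthogonal idempotents $v$ ($v\in E^0$) and elements $f, f^*$ ($f\in E^1$) subject to $s(f)f=fr(f)=f$, $r(f)f^*=f^*s(f)=f^*$, $f^*f'=\delta_{f,f'}r(f)$, and $v=\sum_{s(f)=v}ff^*$ for every $v\in E^0$ with $s^{-1}(v)$ finite and non-empty. Let $X$ be the set of all infinite paths in $E$ and all finite paths in $E$ (vertices included) that end in a sink. For $g\in\mathbb{F}$ with reduced form $ab^{-1}$, where each of $a,b$ is empty or a path of nonzero length and $r(a)=r(b)$ if both are non-empty, let $X_g\subseteq X$ be the set of paths beginning with $a$ if $a$ is non-empty, the set of paths with source $r(b)$ if $a$ is empty and $b$ is not, and $X_e=X$; let $X_g=\emptyset$ for all other $g$. The bijections $\theta_g:X_{g^{-1}}\to X_g$, $b\zeta\mapsto a\zeta$, form a partial action of $\mathbb{F}$ on $X$. Let $1_g$ and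 $1_v$ be the characteristic functions of $X_g$ and of $\{\xi\in X: s(\xi)=v\}$, let $D(X)=D_e$ be the $\mathbb{K}$-span of all $1_g$ ($g\neq e$) and all $1_v$, let $D_g=1_gD(X)$, and let $\alpha_g:D_{g^{-1}}\to D_g$, $\alpha_g(\varphi)=\varphi\circ\theta_{g^{-1}}$. Let $D(X)\star_\alpha\mathbb{F}=\bigoplus_{g\in\mathbb{F}}D_g\delta_g$ be the partial skew group ring, with product $(r\delta_g)(r'\delta_h)=\alpha_g(\alpha_{g^{-1}}(r)r')\delta_{gh}$. Give $L_{\mathbb{K}}(E)$ the $\mathbb{F}$-grading $L_{\mathbb{K}}(E)_g=\varphi^{-1}(D_g\delta_g)$ induced by the $\mathbb{K}$-algebra isomorphism $\varphi:L_{\mathbb{K}}(E)\to D(X)\star_\alpha\mathbb{F}$ with $\varphi(v)=1_v\delta_e$, $\varphi(f)=1_f\delta_f$, $\varphi(f^*)=1_{f^{-1}}\delta_{f^{-1}}$. A $G$-graded ring $R=\bigoplus_{g\in G}R_g$ is strongly graded if $R_gR_h=R_{gh}$ for all $g,h\in G$, where $R_gR_h$ is the set of finite sums of products $xy$ with $x\in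 R_g$, $y\in R_h$; it is graded clean if it has an identity and every homogeneous element (an element of some $R_g$, zero included) is the sum of a homogeneous unit and a homogeneous idempotent. Then $L_{\mathbb{K}}(E)$ is graded clean if and only if it is strongly graded, and this holds if and only if $E$ is a loop, that is, $E$ consists of exactly one vertex and exactly one edge. -/

import Mathlib

/-! ### Graded rings (not necessarily unital) -/

open Classical in
/-- The family of additive subgroups `𝓐 g` is a `G`-grading of the associative ring `R`. -/
structure IsGrading {G R : Type*} [Group G] [NonUnitalRing R] (𝓐 : G → AddSubgroup R) : Prop where
  isInternal : DirectSum.IsInternal 𝓐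
  mul_mem : ∀ {g h : G} {x y : R}, x ∈ 𝓐 g → y ∈ 𝓐 h → x * y ∈ 𝓐 (g * h)

/-- `R` is strongly graded: it is graded, and `R_g R_h = R_{gh}`, where `R_g R_h` is the set of
finite sums of products `x y` with `x ∈ R_g` and `y ∈ R_h`. -/
structure IsStronglyGraded {G R : Type*} [Group G] [NonUnitalRing R] (𝓐 : G → AddSubgroup R) : Prop
    extends IsGrading 𝓐 where
  mul_eq : ∀ g h : G, AddSubgroup.closure {z | ∃ x ∈ 𝓐 g, ∃ y ∈ 𝓐 h, z = x * y} = 𝓐 (g * h)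

/-- `R` is graded clean: it is graded, it has an identity `e`, and every homogeneous element is
the sum of a homogeneous unit and a homogeneous idempotent (here zero counts as homogeneous). -/
structure IsGradedClean {G R : Type*} [Group G] [NonUnitalRing R] (𝓐 : G → AddSubgroup R) : Prop
    extends IsGrading 𝓐 where
  clean : ∃ e : R, (∀ x, e * x = x ∧ x * e = x) ∧
    ∀ x, SetLike.IsHomogeneousElem 𝓐 x → ∃ u a : R, x = u + a ∧
      (SetLike.IsHomogeneousElem 𝓐 u ∧ ∃ w, u * w = e ∧ w * u = e) ∧
      (SetLike.IsHomogeneousElem 𝓐 a ∧ a * a = a)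

universe u v w

/-- A directed graph with vertex set `V` and edge set `A`, given by source and range maps. -/
structure DirGraph (V : Type u) (A : Type v) where
  src : A → V
  rng : A → V

namespace DirGraph

variable {V : Type u} {A : Type v}

/-- A sink is a vertex that emits no edge. -/
def IsSink (E : DirGraph V A) (x : V) : Prop := ∀ f, E.src f ≠ x

/-- The graph `E` is a loop: it consists of one vertex and one edge at that vertex. -/
def IsLoop (E : DirGraph V A) : Prop :=
  ∃ (x : V) (f : A), E.src f = x ∧ E.rng f = x ∧ (∀ y : V, y = x) ∧ (∀ f' : A, f' = f)

/-! ### The Leavitt path algebra, by generators and relations -/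

/-- Generators: vertices, edges `f`, and ghost edges `f*`. -/
inductive Gen (V : Type u) (A : Type v) : Type (max u v)
  | vert (x : V) : Gen V A
  | edge (f : A) : Gen V A
  | ghost (f : A) : Gen V A

/-- The free (non-unital, associative) `K`-algebra on the generators. -/
abbrev FreeAlg (K : Type w) [Field K] (V : Type u) (A : Type v) : Type (max u v w) :=
  MonoidAlgebra K (FreeSemigroup (Gen V A))

variable (K : Type w) [Field K]

/-- A generator, as an element of the free algebra. -/
noncomputable def gen (t : Gen V A) : FreeAlg K V A :=
  MonoidAlgebra.single (FreeSemigroup.of t) 1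

open Gen in
/-- The defining relations of the Leavitt path algebra. -/
inductive Rel (E : DirGraph V A) : FreeAlg K V A → FreeAlg K V A → Prop
  | idem (x : V) : Rel E (gen K (vert x) * gen K (vert x)) (gen K (vert x))
  | orth (x y : V) (h : x ≠ y) : Rel E (gen K (vert x) * gen K (vert y)) 0
  | src_edge (f : A) : Rel E (gen K (vert (E.src f)) * gen K (edge f)) (gen K (edge f))
  | edge_rng (f : A) : Rel E (gen K (edge f) * gen K (vert (E.rng f))) (gen K (edge f))
  | rng_ghost (f : A) : Rel E (gen K (vert (E.rng f)) * gen K (ghost f)) (gen K (ghost f))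
  | ghost_src (f : A) : Rel E (gen K (ghost f) * gen K (vert (E.src f))) (gen K (ghost f))
  | ghost_edge_same (f : A) :
      Rel E (gen K (ghost f) * gen K (edge f)) (gen K (vert (E.rng f)))
  | ghost_edge_ne (f f' : A) (h : f ≠ f') : Rel E (gen K (ghost f) * gen K (edge f')) 0
  | sum_eq (x : V) (hfin : {f | E.src f = x}.Finite) (hne : {f | E.src f = x}.Nonempty) :
      Rel E (gen K (vert x)) (∑ f ∈ hfin.toFinset, gen K (edge f) * gen K (ghost f))

/-- The ring congruence generated by all scalar multiples of the defining relations; it is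
the smallest `K`-algebra congruence that contains them. -/
noncomputable def con (E : DirGraph V A) : RingCon (FreeAlg K V A) :=
  ringConGen fun p q => ∃ (c : K) (p' q' : FreeAlg K V A), Rel K E p' q' ∧ p = c • p' ∧ q = c • q'

theorem con_smul (E : DirGraph V A) (c : K) (p q : FreeAlg K V A) (h : con K E p q) :
    con K E (c • p) (c • q) := by
  have h' : RingConGen.Rel _ p q := h
  change RingConGen.Rel _ _ _
  clear h
  induction h' with
  | of p q hpq =>
    obtain ⟨d, p', q', hr, rfl, rfl⟩ := hpq
    exact .of _ _ ⟨c * d, p', q', hr, smul_smul _ _ _, smul_smul _ _ _⟩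
  | refl x => exact .refl _
  | symm _ ih => exact .symm ih
  | trans _ _ ih1 ih2 => exact .trans ih1 ih2
  | add _ _ ih1 ih2 => rw [smul_add, smul_add]; exact .add ih1 ih2
  | mul _ h2 ih1 _ => rw [← smul_mul_assoc, ← smul_mul_assoc]; exact .mul ih1 h2

/-- The Leavitt path algebra `L_K(E)`, an associative and in general non-unital `K`-algebra. -/
def LPA (E : DirGraph V A) : Type (max u v w) := (con K E).Quotient

noncomputable instance (E : DirGraph V A) : NonUnitalRing (LPA K E) :=
  inferInstanceAs (NonUnitalRing (con K E).Quotient)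

variable {K}

/-- The quotient map from the free algebra. -/
noncomputable def toLPA (E : DirGraph V A) (p : FreeAlg K V A) : LPA K E :=
  ((p : (con K E).Quotient) : LPA K E)

theorem toLPA_surjective (E : DirGraph V A) :
    Function.Surjective (toLPA (K := K) E) := Quotient.mk''_surjective

theorem toLPA_eq (E : DirGraph V A) {p q : FreeAlg K V A} (h : con K E p q) :
    toLPA E p = toLPA E q := (RingCon.eq _).2 h

noncomputable instance (E : DirGraph V A) : SMul K (LPA K E) :=
  ⟨fun c => (con K E).smulAux (fun c p q h => con_smul K E c p q h) c⟩

theorem toLPA_add (E : DirGraph V A) (p q : FreeAlg K V A) :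
    toLPA E (p + q) = toLPA E p + toLPA E q := rfl

theorem toLPA_mul (E : DirGraph V A) (p q : FreeAlg K V A) :
    toLPA E (p * q) = toLPA E p * toLPA E q := rfl

theorem toLPA_zero (E : DirGraph V A) : toLPA E (0 : FreeAlg K V A) = 0 := rfl

theorem toLPA_smul (E : DirGraph V A) (c : K) (p : FreeAlg K V A) :
    toLPA E (c • p) = c • toLPA E p := rfl

noncomputable instance (E : DirGraph V A) : Module K (LPA K E) :=
  (toLPA_surjective E).module K ⟨⟨toLPA E, toLPA_zero E⟩, toLPA_add E⟩ (toLPA_smul E)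

instance (E : DirGraph V A) : IsScalarTower K (LPA K E) (LPA K E) :=
  ⟨fun c x y => by
    obtain ⟨p, rfl⟩ := toLPA_surjective E x
    obtain ⟨q, rfl⟩ := toLPA_surjective E y
    simp only [smul_eq_mul, ← toLPA_smul, ← toLPA_mul, smul_mul_assoc]⟩

instance (E : DirGraph V A) : SMulCommClass K (LPA K E) (LPA K E) :=
  ⟨fun c x y => by
    obtain ⟨p, rfl⟩ := toLPA_surjective E x
    obtain ⟨q, rfl⟩ := toLPA_surjective E y
    simp only [smul_eq_mul, ← toLPA_smul, ← toLPA_mul, mul_smul_comm]⟩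

theorem toLPA_rel (E : DirGraph V A) {p q : FreeAlg K V A} (h : Rel K E p q) :
    toLPA E p = toLPA E q :=
  toLPA_eq E (RingConGen.Rel.of _ _ ⟨1, p, q, h, (one_smul _ _).symm, (one_smul _ _).symm⟩)

/-- The `K`-algebra homomorphism out of `L_K(E)` determined by images of the generators that
satisfy the defining relations. -/
noncomputable def LPA.lift (E : DirGraph V A) {S : Type*} [NonUnitalRing S] [Module K S]
    [IsScalarTower K S S] [SMulCommClass K S S] (F : Gen V A → S)
    (hF : ∀ p q, Rel K E p q →
      MonoidAlgebra.liftMagma K (FreeSemigroup.lift F) p =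
        MonoidAlgebra.liftMagma K (FreeSemigroup.lift F) q) :
    LPA K E →ₙₐ[K] S :=
  let Φ : FreeAlg K V A →ₙₐ[K] S := MonoidAlgebra.liftMagma K (FreeSemigroup.lift F)
  have key : ∀ p q, con K E p q → Φ p = Φ q := fun p q h => by
    have h' : RingConGen.Rel _ p q := h
    clear h
    induction h' with
    | of p q hpq =>
      obtain ⟨d, p', q', hr, rfl, rfl⟩ := hpq
      rw [map_smul, map_smul]; exact congrArg _ (hF _ _ hr)
    | refl x => rfl
    | symm _ ih => exact ih.symm
    | trans _ _ ih1 ih2 => exact ih1.trans ih2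
    | add _ _ ih1 ih2 => rw [map_add, map_add, ih1, ih2]
    | mul _ _ ih1 ih2 => rw [map_mul, map_mul, ih1, ih2]
  { toFun := fun x => Quotient.liftOn' x Φ key
    map_smul' := fun c x => by
      obtain ⟨p, rfl⟩ := toLPA_surjective E x
      exact map_smul Φ c p
    map_zero' := map_zero Φ
    map_add' := fun x y => by
      obtain ⟨p, rfl⟩ := toLPA_surjective E x
      obtain ⟨q, rfl⟩ := toLPA_surjective E y
      exact map_add Φ p q
    map_mul' := fun x y => by
      obtain ⟨p, rfl⟩ := toLPA_surjective E x
      obtain ⟨q, rfl⟩ := toLPA_surjective E y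
      exact map_mul Φ p q }

theorem LPA.lift_gen (E : DirGraph V A) {S : Type*} [NonUnitalRing S] [Module K S]
    [IsScalarTower K S S] [SMulCommClass K S S] (F : Gen V A → S) (hF) (t : Gen V A) :
    LPA.lift (K := K) E F hF (toLPA E (gen K t)) = F t := by
  change MonoidAlgebra.liftMagma K (FreeSemigroup.lift F) (gen K t) = F t
  simp [gen]

/-! ### The boundary path space and the partial action of the free group -/

/-- The set `X` of all infinite paths and all finite paths (vertices included) that end in a
sink. Such a path is given by the sequence of its edges and the sequence of the vertices it
visits: `edge n = some f` if its `(n+1)`-st edge is `f`, and `edge n = none` if it has at most `n`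
edges, in which case `vert n` is the sink in which it ends. A sink, as a path of length zero, has
no edges at all. -/
@[ext]
structure BoundaryPath (E : DirGraph V A) where
  vert : ℕ → V
  edge : ℕ → Option A
  step : ∀ n f, edge n = some f → E.src f = vert n ∧ E.rng f = vert (n + 1)
  sink_end : ∀ n, edge n = none → E.IsSink (vert n) ∧ vert (n + 1) = vert n

namespace BoundaryPath

variable {E : DirGraph V A}

/-- The source of a boundary path. -/
def source (ξ : E.BoundaryPath) : V := ξ.vert 0

/-- The path `ξ_{n+1} ξ_{n+2} ...`. -/
def drop (n : ℕ) (ξ : E.BoundaryPath) : E.BoundaryPath where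
  vert i := ξ.vert (n + i)
  edge i := ξ.edge (n + i)
  step i f h := ξ.step (n + i) f h
  sink_end i h := ξ.sink_end (n + i) h

/-- `ξ_1 ... ξ_{|a|} = a`. -/
def HasPrefix (a : List A) (ξ : E.BoundaryPath) : Prop :=
  ∀ i, i < a.length → ξ.edge i = a[i]?

/-- The path `fξ`. -/
def cons (f : A) (ξ : E.BoundaryPath) (h : E.rng f = ξ.source) : E.BoundaryPath where
  vert i := Nat.casesOn i (E.src f) ξ.vert
  edge i := Nat.casesOn i (some f) ξ.edge
  step i f' hf := by
    cases i with
    | zero => cases hf; exact ⟨rfl, h⟩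
    | succ i => exact ξ.step i f' hf
  sink_end i hi := by
    cases i with
    | zero => cases hi
    | succ i => exact ξ.sink_end i hi

theorem drop_drop (m n : ℕ) (ξ : E.BoundaryPath) : drop m (drop n ξ) = drop (n + m) ξ := by
  ext1 <;> funext i <;> simp [drop, add_assoc]

theorem drop_zero (ξ : E.BoundaryPath) : drop 0 ξ = ξ := by
  ext1 <;> funext i <;> simp [drop]

theorem hasPrefix_nil (ξ : E.BoundaryPath) : HasPrefix [] ξ := fun i h => by simp at h

theorem hasPrefix_append {a c : List A} {ξ : E.BoundaryPath} :
    HasPrefix (a ++ c) ξ ↔ HasPrefix a ξ ∧ HasPrefix c (drop a.length ξ) := by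
  constructor
  · intro h
    refine ⟨fun i hi => ?_, fun i hi => ?_⟩
    · rw [h i (by simp; omega), List.getElem?_append_left hi]
    · change ξ.edge (a.length + i) = _
      rw [h _ (by simp; omega), List.getElem?_append_right (by omega)]; simp
  · rintro ⟨h1, h2⟩ i hi
    by_cases hi' : i < a.length
    · rw [h1 i hi', List.getElem?_append_left hi']
    · have := h2 (i - a.length) (by simp at hi; omega)
      change ξ.edge (a.length + (i - a.length)) = _ at this
      rw [List.getElem?_append_right (by omega), ← this]; congr 1; omega

theorem hasPrefix_singleton {f : A} {ξ : E.BoundaryPath} :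
    HasPrefix [f] ξ ↔ ξ.edge 0 = some f := by
  constructor
  · intro h; simpa using h 0 (by simp)
  · intro h i hi
    obtain rfl : i = 0 := by simpa using hi
    simpa using h

/-- Two boundary paths with a common first edge and the same remainder are equal. -/
theorem eq_of_drop_one {ξ η : E.BoundaryPath} {f : A} (h1 : ξ.edge 0 = some f)
    (h2 : η.edge 0 = some f) (h : drop 1 ξ = drop 1 η) : ξ = η := by
  have hv := congrArg vert h
  have he := congrArg edge h
  ext1
  · funext i
    cases i with
    | zero => rw [← (ξ.step 0 f h1).1, ← (η.step 0 f h2).1]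
    | succ i => simpa [drop, add_comm] using congrFun hv i
  · funext i
    cases i with
    | zero => rw [h1, h2]
    | succ i => simpa [drop, add_comm] using congrFun he i

theorem eq_of_drop {a : List A} : ∀ {ξ η : E.BoundaryPath}, HasPrefix a ξ → HasPrefix a η →
    drop a.length ξ = drop a.length η → ξ = η := by
  induction a with
  | nil => intro ξ η _ _ h; simpa [drop_zero] using h
  | cons f a ih =>
    intro ξ η h1 h2 h
    rw [← List.singleton_append, hasPrefix_append] at h1 h2
    refine eq_of_drop_one (hasPrefix_singleton.1 h1.1) (hasPrefix_singleton.1 h2.1) ?_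
    refine ih h1.2 h2.2 ?_
    rw [drop_drop, drop_drop]; simpa [add_comm] using h

/-- Two prefixes of the same boundary path are comparable. -/
theorem prefix_total {a b : List A} {ξ : E.BoundaryPath} (h1 : HasPrefix a ξ)
    (h2 : HasPrefix b ξ) (h : a.length ≤ b.length) : ∃ c, b = a ++ c := by
  refine ⟨b.drop a.length, ?_⟩
  have : a = b.take a.length := by
    apply List.ext_getElem?
    intro i
    by_cases hi : i < a.length
    · rw [← h1 i hi, h2 i (by omega), List.getElem?_take_of_lt hi]
    · rw [List.getElem?_eq_none (by omega), List.getElem?_eq_none (by simp; omega)]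
  conv_rhs => rw [this]
  simp [List.take_append_drop, min_eq_left h]

end BoundaryPath

open BoundaryPath

/-- `b` is the empty word, or a path of nonzero length with range `x`. -/
def IsPathTo (E : DirGraph V A) (b : List A) (x : V) : Prop :=
  b.IsChain (fun f f' => E.rng f = E.src f') ∧ ∀ f ∈ b.getLast?, E.rng f = x

/-- The word `ab⁻¹` in the letters `f, f⁻¹`, for words `a, b` in the edges. -/
def word (a b : List A) : List (A × Bool) :=
  a.map (fun f => (f, true)) ++ (b.map (fun f => (f, false))).reverse

/-- `ab⁻¹` is the reduced form of `g`. -/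
def IsReducedForm (g : FreeGroup A) (a b : List A) : Prop :=
  g = FreeGroup.mk (word a b) ∧ FreeGroup.IsReduced (word a b)

/-- The set `X_g`. If `ab⁻¹` is the reduced form of `g`, where `a` and `b` are paths with
`r(a) = r(b)` if both are nonempty, it consists of the boundary paths that begin with `a`, if `a` is
nonempty, and of the boundary paths with source `r(b)`, if `a` is empty and `b` is not; it is `X` for
`g = 1`, and it is empty if `g` has no such reduced form. -/
def dom (E : DirGraph V A) (g : FreeGroup A) : Set E.BoundaryPath :=
  {ξ | ∃ a b, IsReducedForm g a b ∧ HasPrefix a ξ ∧ E.IsPathTo b (ξ.vert a.length)}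

/-- `ξ = θ_g(η)`: if `ab⁻¹` is the reduced form of `g`, then `η = bζ` and `ξ = aζ` for
some boundary path `ζ`. -/
def IsTheta (E : DirGraph V A) (g : FreeGroup A) (η ξ : E.BoundaryPath) : Prop :=
  ∃ a b, IsReducedForm g a b ∧ HasPrefix b η ∧ HasPrefix a ξ ∧ drop a.length ξ = drop b.length η

open Classical in
/-- The map `θ_g : X_{g⁻¹} → X_g` (with an irrelevant value outside `X_{g⁻¹}`). -/
noncomputable def theta (E : DirGraph V A) (g : FreeGroup A) (η : E.BoundaryPath) :
    E.BoundaryPath :=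
  if h : ∃ ξ, E.IsTheta g η ξ then h.choose else η

section PartialAction

variable {E : DirGraph V A}

/-- The positive element of the free group given by a word in the edges. -/
def pos (a : List A) : FreeGroup A := FreeGroup.mk (a.map fun f => (f, true))

theorem pos_append (a b : List A) : pos (a ++ b) = pos a * pos b := by
  simp [pos, FreeGroup.mul_mk]

theorem pos_singleton (f : A) : pos [f] = FreeGroup.of f := rfl

theorem pos_nil : pos ([] : List A) = 1 := rfl

theorem mk_word (a b : List A) : FreeGroup.mk (word a b) = pos a * (pos b)⁻¹ := by
  simp [word, pos, FreeGroup.inv_mk, FreeGroup.invRev, FreeGroup.mul_mk, Function.comp_def]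

theorem pos_injective : Function.Injective (pos : List A → FreeGroup A) := by
  intro a b h
  have hred : ∀ c : List A, FreeGroup.IsReduced (c.map fun f => (f, true)) := by
    intro c
    unfold FreeGroup.IsReduced
    rw [List.isChain_map]
    simp [List.isChain_iff_getElem]
  obtain ⟨L, h1, h2⟩ := FreeGroup.Red.exact.1 h
  rw [(hred a).red_iff_eq] at h1
  rw [(hred b).red_iff_eq] at h2
  exact List.map_injective_iff.2 (fun x y hxy => by simpa using hxy) (h1.symm.trans h2)

theorem isReduced_word {a b : List A} :
    FreeGroup.IsReduced (word a b) ↔ ∀ f, ¬ (f ∈ a.getLast? ∧ f ∈ b.getLast?) := by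
  unfold FreeGroup.IsReduced word
  rw [List.isChain_append, List.isChain_reverse, List.isChain_map, List.isChain_map]
  constructor
  · rintro ⟨-, -, h⟩ f ⟨h1, h2⟩
    have := h (f, true) (by simpa using h1) (f, false) (by simpa using h2) rfl
    simp at this
  · intro h
    refine ⟨by simp [List.isChain_iff_getElem], by simp [List.isChain_iff_getElem], ?_⟩
    rintro ⟨x, s⟩ hx ⟨y, t⟩ hy hxy
    simp at hx hy hxy
    obtain ⟨hx, rfl⟩ := hx
    obtain ⟨hy, rfl⟩ := hy
    subst hxy
    exact absurd ⟨hx, hy⟩ (h x)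

theorem isTheta_of (g : FreeGroup A) (η ξ : E.BoundaryPath) (a b : List A)
    (hg : g = pos a * (pos b)⁻¹) (hb : HasPrefix b η) (ha : HasPrefix a ξ)
    (hd : drop a.length ξ = drop b.length η) : E.IsTheta g η ξ := by
  induction a using List.reverseRecOn generalizing b with
  | nil =>
    exact ⟨[], b, ⟨by rw [mk_word, hg], isReduced_word.2 (by simp)⟩, hb, ha, hd⟩
  | append_singleton a f ih =>
    rcases List.eq_nil_or_concat' b with rfl | ⟨b', f', rfl⟩
    · exact ⟨_, _, ⟨by rw [mk_word, hg], isReduced_word.2 (by simp)⟩, hb, ha, hd⟩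
    · by_cases hf : f = f'
      · subst hf
        rw [hasPrefix_append] at ha hb
        refine ih b' ?_ hb.1 ha.1 ?_
        · rw [hg, pos_append, pos_append]; group
        · refine eq_of_drop_one (hasPrefix_singleton.1 ha.2) (hasPrefix_singleton.1 hb.2) ?_
          rw [drop_drop, drop_drop]; simpa using hd
      · refine ⟨_, _, ⟨by rw [mk_word, hg], isReduced_word.2 ?_⟩, hb, ha, hd⟩
        rintro x ⟨h1, h2⟩
        simp at h1 h2
        exact hf (h1.trans h2.symm)

theorem isTheta_iff {g : FreeGroup A} {η ξ : E.BoundaryPath} : E.IsTheta g η ξ ↔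
    ∃ a b, g = pos a * (pos b)⁻¹ ∧ HasPrefix b η ∧ HasPrefix a ξ ∧
      drop a.length ξ = drop b.length η := by
  constructor
  · rintro ⟨a, b, ⟨hg, -⟩, h⟩
    exact ⟨a, b, by rw [hg, mk_word], h⟩
  · rintro ⟨a, b, hg, h1, h2, h3⟩
    exact isTheta_of g η ξ a b hg h1 h2 h3

theorem isTheta_one {η ξ : E.BoundaryPath} (h : E.IsTheta 1 η ξ) : η = ξ := by
  obtain ⟨a, b, hg, hb, ha, hd⟩ := isTheta_iff.1 h
  obtain rfl : a = b := pos_injective (mul_inv_eq_one.1 hg.symm)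
  exact (eq_of_drop ha hb hd).symm

theorem isTheta_refl (ξ : E.BoundaryPath) : E.IsTheta 1 ξ ξ :=
  isTheta_iff.2 ⟨[], [], by simp [pos_nil], hasPrefix_nil _, hasPrefix_nil _, rfl⟩

theorem IsTheta.symm {g : FreeGroup A} {η ξ : E.BoundaryPath} (h : E.IsTheta g η ξ) :
    E.IsTheta g⁻¹ ξ η := by
  obtain ⟨a, b, hg, hb, ha, hd⟩ := isTheta_iff.1 h
  exact isTheta_iff.2 ⟨b, a, by rw [hg]; group, ha, hb, hd.symm⟩

theorem IsTheta.trans {g h : FreeGroup A} {ζ η ξ : E.BoundaryPath} (h1 : E.IsTheta g η ξ)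
    (h2 : E.IsTheta h ζ η) : E.IsTheta (g * h) ζ ξ := by
  obtain ⟨a, b, hg, hb, ha, hd⟩ := isTheta_iff.1 h1
  obtain ⟨a', b', hg', hb', ha', hd'⟩ := isTheta_iff.1 h2
  rcases le_total b.length a'.length with hl | hl
  · obtain ⟨c, rfl⟩ := prefix_total hb ha' hl
    rw [hasPrefix_append] at ha'
    refine isTheta_iff.2 ⟨a ++ c, b', ?_, hb', ?_, ?_⟩
    · rw [hg, hg', pos_append, pos_append]; group
    · rw [hasPrefix_append, hd]; exact ⟨ha, ha'.2⟩
    · rw [List.length_append, ← drop_drop, hd, drop_drop, ← hd', List.length_append]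
  · obtain ⟨c, rfl⟩ := prefix_total ha' hb hl
    rw [hasPrefix_append] at hb
    refine isTheta_iff.2 ⟨a, b' ++ c, ?_, ?_, ha, ?_⟩
    · rw [hg, hg', pos_append, pos_append]; group
    · rw [hasPrefix_append, ← hd']; exact ⟨hb', hb.2⟩
    · rw [hd, List.length_append, List.length_append, ← drop_drop, hd', drop_drop]

theorem IsTheta.unique {g : FreeGroup A} {η ξ ξ' : E.BoundaryPath} (h : E.IsTheta g η ξ)
    (h' : E.IsTheta g η ξ') : ξ = ξ' := by
  have := h'.trans h.symm
  rw [mul_inv_cancel] at this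
  exact isTheta_one this

theorem exists_concat (b : List A) (ζ : E.BoundaryPath) (h : E.IsPathTo b ζ.source) :
    ∃ η : E.BoundaryPath, HasPrefix b η ∧ drop b.length η = ζ := by
  induction b using List.reverseRecOn generalizing ζ with
  | nil => exact ⟨ζ, hasPrefix_nil _, drop_zero _⟩
  | append_singleton b f ih =>
    obtain ⟨hc, hl⟩ := h
    have hf : E.rng f = ζ.source := hl f (by simp)
    obtain ⟨η, h1, h2⟩ := ih (ζ.cons f hf) ⟨(List.isChain_append.1 hc).1, fun f' hf' =>
      (List.isChain_append.1 hc).2.2 f' hf' f (by simp)⟩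
    refine ⟨η, hasPrefix_append.2 ⟨h1, ?_⟩, ?_⟩
    · rw [h2, hasPrefix_singleton]; rfl
    · rw [List.length_append, ← drop_drop, h2]
      ext1 <;> funext i <;> simp [drop, cons, add_comm 1 i]

theorem isPathTo_of_hasPrefix {b : List A} {η : E.BoundaryPath} (h : HasPrefix b η) :
    E.IsPathTo b (η.vert b.length) := by
  induction b using List.reverseRecOn with
  | nil => exact ⟨List.isChain_nil, by simp⟩
  | append_singleton b f ih =>
    rw [hasPrefix_append, hasPrefix_singleton] at h
    have h2 := (η.step _ _ h.2)
    refine ⟨List.isChain_append.2 ⟨(ih h.1).1, by simp, ?_⟩, ?_⟩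
    · intro f' hf' f'' hf''
      obtain rfl : f = f'' := by simpa using hf''
      rw [(ih h.1).2 f' hf', h2.1]; rfl
    · intro f' hf'
      obtain rfl : f = f' := by simpa using hf'
      rw [h2.2]; simp

theorem mem_dom_iff {g : FreeGroup A} {ξ : E.BoundaryPath} :
    ξ ∈ E.dom g ↔ ∃ η, E.IsTheta g η ξ := by
  constructor
  · rintro ⟨a, b, hr, ha, hb⟩
    obtain ⟨η, h1, h2⟩ := exists_concat b (drop a.length ξ) (by simpa [source, drop] using hb)
    exact ⟨η, a, b, hr, h1, ha, h2.symm⟩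
  · rintro ⟨η, a, b, hr, hb, ha, hd⟩
    refine ⟨a, b, hr, ha, ?_⟩
    have := congrArg source hd
    simp only [source, drop, add_zero] at this
    rw [this]
    exact isPathTo_of_hasPrefix hb

theorem IsTheta.eq {g : FreeGroup A} {η ξ : E.BoundaryPath} (h : E.IsTheta g η ξ) :
    E.theta g η = ξ := by
  have h' : ∃ ξ, E.IsTheta g η ξ := ⟨ξ, h⟩
  rw [theta, dif_pos h']
  exact h'.choose_spec.unique h

theorem isTheta_theta {g : FreeGroup A} {ξ : E.BoundaryPath} (h : ξ ∈ E.dom g) :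
    E.IsTheta g (E.theta g⁻¹ ξ) ξ := by
  obtain ⟨η, hη⟩ := mem_dom_iff.1 h
  rwa [hη.symm.eq]

theorem isTheta_of_edge {f : A} {η ξ : E.BoundaryPath} :
    E.IsTheta (FreeGroup.of f) η ξ ↔ ξ.edge 0 = some f ∧ drop 1 ξ = η := by
  constructor
  · intro h
    obtain ⟨a, b, hg, hb, ha, hd⟩ := isTheta_iff.1 h
    obtain rfl : a = [f] ++ b := by
      apply pos_injective
      rw [pos_append, pos_singleton, hg]; group
    rw [hasPrefix_append] at ha
    refine ⟨hasPrefix_singleton.1 ha.1, eq_of_drop ha.2 hb ?_⟩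
    rw [← hd, List.length_append, drop_drop]; rfl
  · rintro ⟨h1, h2⟩
    exact isTheta_iff.2 ⟨[f], [], by simp [pos_nil, pos_singleton], hasPrefix_nil _,
      hasPrefix_singleton.2 h1, by simpa [drop_zero] using h2⟩

theorem mem_dom_of {f : A} {ξ : E.BoundaryPath} :
    ξ ∈ E.dom (FreeGroup.of f) ↔ ξ.edge 0 = some f := by
  rw [mem_dom_iff]
  simp [isTheta_of_edge]

theorem isTheta_of_inv {f : A} {η ξ : E.BoundaryPath} :
    E.IsTheta (FreeGroup.of f)⁻¹ η ξ ↔ η.edge 0 = some f ∧ drop 1 η = ξ := by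
  rw [← isTheta_of_edge]
  exact ⟨fun h => by simpa using h.symm, fun h => h.symm⟩

theorem mem_dom_of_inv {f : A} {ξ : E.BoundaryPath} :
    ξ ∈ E.dom (FreeGroup.of f)⁻¹ ↔ ξ.source = E.rng f := by
  rw [mem_dom_iff]
  constructor
  · rintro ⟨η, h⟩
    obtain ⟨h1, rfl⟩ := isTheta_of_inv.1 h
    simpa [source, drop] using (η.step 0 f h1).2.symm
  · intro h
    refine ⟨ξ.cons f h.symm, isTheta_of_inv.2 ⟨rfl, ?_⟩⟩
    ext1 <;> funext i <;> simp [drop, cons, add_comm 1 i]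

theorem mem_dom_one (ξ : E.BoundaryPath) : ξ ∈ E.dom 1 := mem_dom_iff.2 ⟨ξ, isTheta_refl ξ⟩

theorem mem_dom_pos {a : List A} {ξ : E.BoundaryPath} :
    ξ ∈ E.dom (pos a) ↔ HasPrefix a ξ := by
  rw [mem_dom_iff]
  constructor
  · rintro ⟨η, h⟩
    obtain ⟨a', b, hg, hb, ha, hd⟩ := isTheta_iff.1 h
    obtain rfl : a' = a ++ b := by
      apply pos_injective
      rw [pos_append, hg]; group
    exact (hasPrefix_append.1 ha).1
  · intro h
    exact ⟨_, isTheta_iff.2 ⟨a, [], by simp [pos_nil], hasPrefix_nil _, h, (drop_zero _).symm⟩⟩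

end PartialAction

/-! ### The partial skew group ring `D(X) ⋆ 𝔽` -/

section SkewRing

variable (K) (E : DirGraph V A)

/-- The characteristic function `1_g` of `X_g`. -/
noncomputable def oneG (g : FreeGroup A) : E.BoundaryPath → K := (E.dom g).indicator 1

/-- The characteristic function `1_x` of the set `X_x` of boundary paths with source `x`. -/
noncomputable def oneV (x : V) : E.BoundaryPath → K := {ξ | ξ.source = x}.indicator 1

/-- `D(X) = D_1`, the linear span of all `1_g`, `g ≠ 1`, and all `1_x`. -/
def DX : Submodule K (E.BoundaryPath → K) :=
  Submodule.span K ({φ | ∃ g : FreeGroup A, g ≠ 1 ∧ φ = oneG K E g} ∪ {φ | ∃ x, φ = oneV K E x})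

/-- The ideal `D_g = 1_g D(X)` of `D(X)`. -/
noncomputable def D (g : FreeGroup A) : Submodule K (E.BoundaryPath → K) :=
  (DX K E).map (LinearMap.mulLeft K (oneG K E g))

open Classical in
/-- `α_g(φ) = φ ∘ θ_{g⁻¹}` on `X_g`, extended by zero. -/
noncomputable def alpha (g : FreeGroup A) (φ : E.BoundaryPath → K) : E.BoundaryPath → K :=
  fun ξ => if ξ ∈ E.dom g then φ (E.theta g⁻¹ ξ) else 0

/-- The partial skew group ring `D(X) ⋆ 𝔽 = ⨁ D_g δ_g`, where `r δ_g` is the finitely supported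
function with value `r` at `g`. -/
noncomputable def Skew : Submodule K (FreeGroup A →₀ (E.BoundaryPath → K)) where
  carrier := {p | ∀ g, p g ∈ D K E g}
  add_mem' hp hq g := (D K E g).add_mem (hp g) (hq g)
  zero_mem' g := (D K E g).zero_mem
  smul_mem' c _ hp g := (D K E g).smul_mem c (hp g)

/-- The bi-additive extension of `(r δ_g) (r' δ_h) = α_g(α_{g⁻¹}(r) r') δ_{gh}`. -/
noncomputable def skewMul (p q : FreeGroup A →₀ (E.BoundaryPath → K)) :
    FreeGroup A →₀ (E.BoundaryPath → K) :=
  p.sum fun g r => q.sum fun h r' =>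
    Finsupp.single (g * h) (alpha K E g (alpha K E g⁻¹ r * r'))

variable {K E}

theorem alpha_add (g : FreeGroup A) (φ ψ : E.BoundaryPath → K) :
    alpha K E g (φ + ψ) = alpha K E g φ + alpha K E g ψ := by
  funext ξ; simp only [alpha, Pi.add_apply]; split_ifs <;> simp

theorem alpha_smul (g : FreeGroup A) (c : K) (φ : E.BoundaryPath → K) :
    alpha K E g (c • φ) = c • alpha K E g φ := by
  funext ξ; simp only [alpha, Pi.smul_apply]; split_ifs <;> simp

theorem alpha_zero (g : FreeGroup A) : alpha K E g (0 : E.BoundaryPath → K) = 0 := by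
  funext ξ; simp [alpha]

theorem alpha_apply_of {g : FreeGroup A} {η ξ : E.BoundaryPath} (h : E.IsTheta g η ξ)
    (φ : E.BoundaryPath → K) : alpha K E g φ ξ = φ η := by
  rw [alpha, if_pos (mem_dom_iff.2 ⟨η, h⟩), h.symm.eq]

theorem alpha_apply_not {g : FreeGroup A} {ξ : E.BoundaryPath} (h : ξ ∉ E.dom g)
    (φ : E.BoundaryPath → K) : alpha K E g φ ξ = 0 := by
  rw [alpha, if_neg h]

theorem alpha_one (φ : E.BoundaryPath → K) : alpha K E 1 φ = φ :=
  funext fun ξ => alpha_apply_of (isTheta_refl ξ) φ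

theorem mulCoeff (g : FreeGroup A) (r r' : E.BoundaryPath → K) :
    alpha K E g (alpha K E g⁻¹ r * r') = (E.dom g).indicator r * alpha K E g r' := by
  funext ξ
  by_cases h : ξ ∈ E.dom g
  · have h' := isTheta_theta h
    rw [alpha_apply_of h', Pi.mul_apply, Pi.mul_apply, alpha_apply_of h', alpha_apply_of h'.symm,
      Set.indicator_of_mem h]
  · rw [alpha_apply_not h, Pi.mul_apply, alpha_apply_not h, mul_zero]

theorem oneG_one : oneG K E 1 = 1 := by
  funext ξ; simp [oneG, mem_dom_one]

theorem dom_cases {g : FreeGroup A} (hg : g ≠ 1) : E.dom g = ∅ ∨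
    (∃ a, a ≠ [] ∧ E.dom g = {ξ | HasPrefix a ξ}) ∨ ∃ x, E.dom g = {ξ | ξ.source = x} := by
  rcases (E.dom g).eq_empty_or_nonempty with h | ⟨ξ₀, a, b, hr, ha, hb⟩
  · exact Or.inl h
  right
  have huniq : ∀ a' b', IsReducedForm g a' b' → a' = a ∧ b' = b := by
    intro a' b' hr'
    obtain ⟨L, h1, h2⟩ := FreeGroup.Red.exact.1 (hr'.1.symm.trans hr.1)
    rw [hr'.2.red_iff_eq] at h1
    rw [hr.2.red_iff_eq] at h2
    have hw := h1.symm.trans h2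
    have e1 := congrArg (fun l : List (A × Bool) => (l.filter (fun x => x.2)).map Prod.fst) hw
    have e2 := congrArg (fun l : List (A × Bool) => (l.filter (fun x => !x.2)).map Prod.fst) hw
    simp [word, List.filter_map, List.filter_reverse, Function.comp_def] at e1 e2
    exact ⟨e1, e2⟩
  by_cases hnil : a = []
  · right
    subst hnil
    have hbne : b ≠ [] := by
      rintro rfl
      exact hg (by rw [hr.1, mk_word]; simp [pos_nil])
    refine ⟨ξ₀.source, Set.ext fun ξ => ⟨?_, fun h => ?_⟩⟩
    · rintro ⟨a', b', hr', -, hb'⟩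
      obtain ⟨rfl, rfl⟩ := huniq _ _ hr'
      have h1 := hb.2 _ (List.getLast_mem_getLast? hbne)
      have h2 := hb'.2 _ (List.getLast_mem_getLast? hbne)
      exact h2.symm.trans h1
    · refine ⟨[], b, hr, hasPrefix_nil _, ?_⟩
      have h' : ξ.vert 0 = ξ₀.vert 0 := h
      simpa [h'] using hb
  · left
    refine ⟨a, hnil, Set.ext fun ξ => ⟨?_, fun h => ?_⟩⟩
    · rintro ⟨a', b', hr', ha', -⟩
      obtain ⟨rfl, rfl⟩ := huniq _ _ hr'
      exact ha'
    · refine ⟨a, b, hr, h, ?_⟩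
      have h1 := (isPathTo_of_hasPrefix ha).2 _ (List.getLast_mem_getLast? hnil)
      have h2 := (isPathTo_of_hasPrefix (show HasPrefix a ξ from h)).2 _
        (List.getLast_mem_getLast? hnil)
      rw [← h2, h1]; exact hb

theorem source_of_hasPrefix {a : List A} (ha : a ≠ []) {ξ ξ' : E.BoundaryPath}
    (h : HasPrefix a ξ) (h' : HasPrefix a ξ') : ξ.source = ξ'.source := by
  obtain ⟨f, a, rfl⟩ := List.exists_cons_of_ne_nil ha
  have h1 := (ξ.step 0 f (by simpa using h 0 (by simp))).1
  have h2 := (ξ'.step 0 f (by simpa using h' 0 (by simp))).1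
  exact h1.symm.trans h2

theorem source_of_dom {g : FreeGroup A} (hg : g ≠ 1) {ξ ξ' : E.BoundaryPath}
    (h : ξ ∈ E.dom g) (h' : ξ' ∈ E.dom g) : ξ.source = ξ'.source := by
  rcases dom_cases (E := E) hg with hd | ⟨a, ha, hd⟩ | ⟨x, hd⟩
  · rw [hd] at h; exact h.elim
  · rw [hd] at h h'; exact source_of_hasPrefix ha h h'
  · rw [hd] at h h'; exact h.trans h'.symm

theorem oneG_mem {g : FreeGroup A} (hg : g ≠ 1) : oneG K E g ∈ DX K E :=
  Submodule.subset_span (Or.inl ⟨g, hg, rfl⟩)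

theorem oneV_mem (x : V) : oneV K E x ∈ DX K E :=
  Submodule.subset_span (Or.inr ⟨x, rfl⟩)

theorem pos_ne_one {a : List A} (ha : a ≠ []) : pos a ≠ 1 := fun h =>
  ha (pos_injective (h.trans pos_nil.symm))

theorem indicator_prefix (a : List A) :
    ({ξ | HasPrefix a ξ}.indicator 1 : E.BoundaryPath → K) = oneG K E (pos a) := by
  unfold oneG
  congr 1
  ext ξ
  exact mem_dom_pos.symm

theorem gens_mul {φ ψ : E.BoundaryPath → K}
    (hφ : φ ∈ ({φ | ∃ g : FreeGroup A, g ≠ 1 ∧ φ = oneG K E g} ∪ {φ | ∃ x, φ = oneV K E x} :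
      Set (E.BoundaryPath → K)))
    (hψ : ψ ∈ ({φ | ∃ g : FreeGroup A, g ≠ 1 ∧ φ = oneG K E g} ∪ {φ | ∃ x, φ = oneV K E x} :
      Set (E.BoundaryPath → K))) : φ * ψ ∈ DX K E := by
  have key : ∀ φ : E.BoundaryPath → K,
      φ ∈ ({φ | ∃ g : FreeGroup A, g ≠ 1 ∧ φ = oneG K E g} ∪ {φ | ∃ x, φ = oneV K E x} :
        Set (E.BoundaryPath → K)) →
      φ = 0 ∨ (∃ a, a ≠ [] ∧ φ = {ξ | HasPrefix a ξ}.indicator 1) ∨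
        ∃ x, φ = {ξ | ξ.source = x}.indicator 1 := by
    rintro φ (⟨g, hg, rfl⟩ | ⟨x, rfl⟩)
    · rcases dom_cases (E := E) hg with hd | ⟨a, ha, hd⟩ | ⟨x, hd⟩
      · left; rw [oneG, hd, Set.indicator_empty]; rfl
      · right; left; exact ⟨a, ha, by rw [oneG, hd]⟩
      · right; right; exact ⟨x, by rw [oneG, hd]⟩
    · right; right; exact ⟨x, rfl⟩
  have hmul : ∀ S T : Set E.BoundaryPath,
      (S.indicator 1 * T.indicator 1 : E.BoundaryPath → K) = (S ∩ T).indicator 1 := by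
    intro S T
    funext ξ
    by_cases h1 : ξ ∈ S <;> by_cases h2 : ξ ∈ T <;> simp [h1, h2]
  have hpre : ∀ a : List A, a ≠ [] →
      ({ξ | HasPrefix a ξ}.indicator 1 : E.BoundaryPath → K) ∈ DX K E := fun a ha => by
    rw [indicator_prefix]; exact oneG_mem (pos_ne_one ha)
  have hzero : ∀ S : Set E.BoundaryPath, S = ∅ → (S.indicator 1 : E.BoundaryPath → K) ∈ DX K E := by
    rintro S rfl; rw [Set.indicator_empty]; exact (DX K E).zero_mem
  have hpv : ∀ (a : List A) (x : V), a ≠ [] →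
      (({ξ | HasPrefix a ξ} ∩ {ξ | ξ.source = x}).indicator 1 : E.BoundaryPath → K) ∈ DX K E := by
    intro a x ha
    rcases ({ξ | HasPrefix a ξ} ∩ {ξ : E.BoundaryPath | ξ.source = x}).eq_empty_or_nonempty with
      h | ⟨ξ₀, h1, h2⟩
    · exact hzero _ h
    · have hsub : {ξ | HasPrefix a ξ} ⊆ {ξ : E.BoundaryPath | ξ.source = x} :=
        fun ξ hξ => (source_of_hasPrefix ha hξ h1).trans h2
      rw [Set.inter_eq_left.2 hsub]
      exact hpre a ha
  rcases key φ hφ with rfl | ⟨a, ha, rfl⟩ | ⟨x, rfl⟩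
  · rw [zero_mul]; exact (DX K E).zero_mem
  · rcases key ψ hψ with rfl | ⟨b, hb, rfl⟩ | ⟨y, rfl⟩
    · rw [mul_zero]; exact (DX K E).zero_mem
    · rw [hmul]
      rcases ({ξ | HasPrefix a ξ} ∩ {ξ : E.BoundaryPath | HasPrefix b ξ}).eq_empty_or_nonempty with
        h | ⟨ξ₀, h1, h2⟩
      · exact hzero _ h
      · rcases le_total a.length b.length with hl | hl
        · obtain ⟨c, rfl⟩ := prefix_total h1 h2 hl
          have hsub : {ξ | HasPrefix (a ++ c) ξ} ⊆ {ξ : E.BoundaryPath | HasPrefix a ξ} :=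
            fun ξ hξ => (hasPrefix_append.1 hξ).1
          rw [Set.inter_eq_right.2 hsub]
          exact hpre _ hb
        · obtain ⟨c, rfl⟩ := prefix_total h2 h1 hl
          have hsub : {ξ | HasPrefix (b ++ c) ξ} ⊆ {ξ : E.BoundaryPath | HasPrefix b ξ} :=
            fun ξ hξ => (hasPrefix_append.1 hξ).1
          rw [Set.inter_eq_left.2 hsub]
          exact hpre _ ha
    · rw [hmul]; exact hpv a y ha
  · rcases key ψ hψ with rfl | ⟨b, hb, rfl⟩ | ⟨y, rfl⟩
    · rw [mul_zero]; exact (DX K E).zero_mem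
    · rw [mul_comm, hmul]; exact hpv b x hb
    · rw [hmul]
      rcases eq_or_ne x y with rfl | hxy
      · rw [Set.inter_self]; exact oneV_mem x
      · exact hzero _ (Set.eq_empty_of_forall_notMem fun ξ hξ => hxy (hξ.1.symm.trans hξ.2))

theorem DX_mul {φ ψ : E.BoundaryPath → K} (hφ : φ ∈ DX K E) (hψ : ψ ∈ DX K E) :
    φ * ψ ∈ DX K E := by
  have h : DX K E * DX K E ≤ DX K E := by
    conv_lhs => rw [DX, Submodule.span_mul_span]
    rw [Submodule.span_le]
    rintro _ ⟨φ, hφ, ψ, hψ, rfl⟩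
    exact gens_mul hφ hψ
  exact h (Submodule.mul_mem_mul hφ hψ)

theorem oneG_mul_mem (g : FreeGroup A) {φ : E.BoundaryPath → K} (hφ : φ ∈ DX K E) :
    oneG K E g * φ ∈ DX K E := by
  rcases eq_or_ne g 1 with rfl | hg
  · rwa [oneG_one, one_mul]
  · exact DX_mul (oneG_mem hg) hφ

theorem DX_of_D {g : FreeGroup A} {φ : E.BoundaryPath → K} (hφ : φ ∈ D K E g) : φ ∈ DX K E := by
  obtain ⟨ψ, hψ, rfl⟩ := hφ
  exact oneG_mul_mem g hψ

theorem mem_D {g : FreeGroup A} {φ : E.BoundaryPath → K} (hφ : φ ∈ DX K E) :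
    oneG K E g * φ ∈ D K E g := ⟨φ, hφ, rfl⟩

theorem D_support {g : FreeGroup A} {φ : E.BoundaryPath → K} (hφ : φ ∈ D K E g)
    {ξ : E.BoundaryPath} (hξ : ξ ∉ E.dom g) : φ ξ = 0 := by
  obtain ⟨ψ, hψ, rfl⟩ := hφ
  simp [oneG, hξ]

theorem D_indicator {g : FreeGroup A} {φ : E.BoundaryPath → K} (hφ : φ ∈ D K E g) :
    (E.dom g).indicator φ = φ :=
  Set.indicator_eq_self.2 fun ξ hξ => by
    by_contra h
    exact hξ (D_support hφ h)

theorem alpha_oneG (g k : FreeGroup A) :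
    alpha K E g (oneG K E k) = oneG K E g * oneG K E (g * k) := by
  funext ξ
  by_cases h : ξ ∈ E.dom g
  · have h' := isTheta_theta h
    rw [alpha_apply_of h', Pi.mul_apply]
    have : E.theta g⁻¹ ξ ∈ E.dom k ↔ ξ ∈ E.dom (g * k) := by
      rw [mem_dom_iff, mem_dom_iff]
      constructor
      · rintro ⟨ζ, hζ⟩; exact ⟨ζ, h'.trans hζ⟩
      · rintro ⟨ζ, hζ⟩; exact ⟨ζ, by simpa using h'.symm.trans hζ⟩
    by_cases hk : E.theta g⁻¹ ξ ∈ E.dom k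
    · simp [oneG, h, hk, this.1 hk]
    · have hk' : ξ ∉ E.dom (g * k) := fun hc => hk (this.2 hc)
      simp [oneG, hk, hk']
  · rw [alpha_apply_not h]; simp [oneG, h]

theorem alpha_mem (g : FreeGroup A) {φ : E.BoundaryPath → K} (hφ : φ ∈ DX K E) :
    alpha K E g φ ∈ DX K E := by
  rcases eq_or_ne g 1 with rfl | hg
  · rwa [alpha_one]
  induction hφ using Submodule.span_induction with
  | mem φ h =>
    rcases h with ⟨k, hk, rfl⟩ | ⟨x, rfl⟩
    · rw [alpha_oneG, mul_comm]
      exact oneG_mul_mem _ (oneG_mem hg)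
    · by_cases h : ∃ ξ ∈ E.dom g, (E.theta g⁻¹ ξ).source = x
      · obtain ⟨ξ₀, h0, rfl⟩ := h
        have : alpha K E g (oneV K E (E.theta g⁻¹ ξ₀).source) = oneG K E g := by
          funext ξ
          by_cases h : ξ ∈ E.dom g
          · have h' := isTheta_theta h
            rw [alpha_apply_of h']
            have : (E.theta g⁻¹ ξ).source = (E.theta g⁻¹ ξ₀).source :=
              source_of_dom (inv_ne_one.2 hg) (mem_dom_iff.2 ⟨_, h'.symm⟩)
                (mem_dom_iff.2 ⟨_, (isTheta_theta h0).symm⟩)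
            simp [oneV, oneG, h, this]
          · rw [alpha_apply_not h]; simp [oneG, h]
        rw [this]; exact oneG_mem hg
      · have : alpha K E g (oneV K E x) = 0 := by
          funext ξ
          by_cases h1 : ξ ∈ E.dom g
          · rw [alpha_apply_of (isTheta_theta h1)]
            have h2 : (E.theta g⁻¹ ξ).source ≠ x := fun hc => h ⟨ξ, h1, hc⟩
            simp [oneV, h2]
          · exact alpha_apply_not h1 _
        rw [this]; exact (DX K E).zero_mem
  | zero => rw [alpha_zero]; exact (DX K E).zero_mem
  | add φ ψ _ _ h1 h2 => rw [alpha_add]; exact (DX K E).add_mem h1 h2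
  | smul c φ _ h => rw [alpha_smul]; exact (DX K E).smul_mem c h

theorem mulCoeff_mem {g h : FreeGroup A} {r r' : E.BoundaryPath → K} (hr : r ∈ D K E g)
    (hr' : r' ∈ D K E h) : alpha K E g (alpha K E g⁻¹ r * r') ∈ D K E (g * h) := by
  have : alpha K E g (alpha K E g⁻¹ r * r') = oneG K E (g * h) * (r * alpha K E g r') := by
    rw [mulCoeff, D_indicator hr]
    funext ξ
    by_cases hgh : ξ ∈ E.dom (g * h)
    · simp [oneG, hgh]
    · by_cases hg : ξ ∈ E.dom g
      · have h' := isTheta_theta hg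
        have : E.theta g⁻¹ ξ ∉ E.dom h := fun hc => by
          obtain ⟨ζ, hζ⟩ := mem_dom_iff.1 hc
          exact hgh (mem_dom_iff.2 ⟨ζ, h'.trans hζ⟩)
        simp [oneG, hgh, alpha_apply_of h', D_support hr' this]
      · simp [oneG, hgh, alpha_apply_not hg]
  rw [this]
  exact mem_D (DX_mul (DX_of_D hr) (alpha_mem g (DX_of_D hr')))

theorem skewMul_mem {p q : FreeGroup A →₀ (E.BoundaryPath → K)} (hp : p ∈ Skew K E)
    (hq : q ∈ Skew K E) : skewMul K E p q ∈ Skew K E := by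
  refine Submodule.sum_mem _ fun g _ => Submodule.sum_mem _ fun h _ => fun k => ?_
  classical
  rw [Finsupp.single_apply]
  split_ifs with e
  · rw [← e]; exact mulCoeff_mem (hp g) (hq h)
  · exact Submodule.zero_mem _

theorem mulCoeff_zero_left (g : FreeGroup A) (r' : E.BoundaryPath → K) :
    alpha K E g (alpha K E g⁻¹ 0 * r') = 0 := by rw [alpha_zero, zero_mul, alpha_zero]

theorem mulCoeff_zero_right (g : FreeGroup A) (r : E.BoundaryPath → K) :
    alpha K E g (alpha K E g⁻¹ r * 0) = 0 := by rw [mul_zero, alpha_zero]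

theorem skewMul_add (p q q' : FreeGroup A →₀ (E.BoundaryPath → K)) :
    skewMul K E p (q + q') = skewMul K E p q + skewMul K E p q' := by
  classical
  unfold skewMul
  rw [← Finsupp.sum_add]
  refine Finsupp.sum_congr fun g _ => ?_
  rw [Finsupp.sum_add_index']
  · intro h; rw [mulCoeff_zero_right, Finsupp.single_zero]
  · intro h r r'; rw [mul_add, alpha_add, Finsupp.single_add]

theorem skewMul_add_left (p p' q : FreeGroup A →₀ (E.BoundaryPath → K)) :
    skewMul K E (p + p') q = skewMul K E p q + skewMul K E p' q := by
  classical
  unfold skewMul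
  rw [Finsupp.sum_add_index']
  · intro h; simp only [mulCoeff_zero_left, Finsupp.single_zero, Finsupp.sum_fun_zero]
  · intro h r r'
    rw [← Finsupp.sum_add]
    refine Finsupp.sum_congr fun g _ => ?_
    rw [alpha_add, add_mul, alpha_add, Finsupp.single_add]

theorem skewMul_single (g h : FreeGroup A) (r r' : E.BoundaryPath → K) :
    skewMul K E (Finsupp.single g r) (Finsupp.single h r') =
      Finsupp.single (g * h) (alpha K E g (alpha K E g⁻¹ r * r')) := by
  unfold skewMul
  rw [Finsupp.sum_single_index, Finsupp.sum_single_index]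
  · rw [mulCoeff_zero_right, Finsupp.single_zero]
  · simp only [mulCoeff_zero_left, Finsupp.single_zero, Finsupp.sum_fun_zero]

theorem skewMul_zero (p : FreeGroup A →₀ (E.BoundaryPath → K)) : skewMul K E p 0 = 0 := by
  have := skewMul_add p 0 0
  simpa using this

theorem zero_skewMul (p : FreeGroup A →₀ (E.BoundaryPath → K)) : skewMul K E 0 p = 0 := by
  have := skewMul_add_left 0 0 p
  simpa using this

/-- Every element of `D(X) ⋆ 𝔽` is a sum of elements `r δ_g` with `r ∈ D_g`. -/
theorem skew_induction {P : (FreeGroup A →₀ (E.BoundaryPath → K)) → Prop}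
    {p : FreeGroup A →₀ (E.BoundaryPath → K)} (hp : p ∈ Skew K E) (h0 : P 0)
    (hadd : ∀ p q, P p → P q → P (p + q))
    (hs : ∀ g r, r ∈ D K E g → P (Finsupp.single g r)) : P p := by
  rw [← Finsupp.sum_single p]
  exact Finset.sum_induction _ P hadd h0 fun g _ => hs g _ (hp g)

theorem skewMul_assoc {p q s : FreeGroup A →₀ (E.BoundaryPath → K)} (hp : p ∈ Skew K E)
    (hq : q ∈ Skew K E) (hs : s ∈ Skew K E) :
    skewMul K E (skewMul K E p q) s = skewMul K E p (skewMul K E q s) := by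
  refine skew_induction (P := fun p => skewMul K E (skewMul K E p q) s =
    skewMul K E p (skewMul K E q s)) hp (by simp only [zero_skewMul])
    (fun _ _ h1 h2 => by simp only [skewMul_add_left, h1, h2]) fun g r hr => ?_
  refine skew_induction (P := fun q => skewMul K E (skewMul K E (.single g r) q) s =
    skewMul K E (.single g r) (skewMul K E q s)) hq (by simp only [zero_skewMul, skewMul_zero])
    (fun _ _ h1 h2 => by simp only [skewMul_add_left, skewMul_add, h1, h2]) fun h r' hr' => ?_
  refine skew_induction (P := fun s => skewMul K E (skewMul K E (.single g r) (.single h r')) s =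
    skewMul K E (.single g r) (skewMul K E (.single h r') s)) hs (by simp only [skewMul_zero])
    (fun _ _ h1 h2 => by simp only [skewMul_add, h1, h2]) fun k r'' hr'' => ?_
  rw [skewMul_single, skewMul_single, skewMul_single, skewMul_single, mul_assoc]
  congr 1
  have hgh := mulCoeff_mem hr hr'
  rw [mulCoeff (g * h), D_indicator hgh, mulCoeff, mulCoeff, mulCoeff, D_indicator hr,
    D_indicator hr', mul_assoc]
  congr 1
  funext ξ
  by_cases hg : ξ ∈ E.dom g
  · have h' := isTheta_theta hg
    rw [Pi.mul_apply, alpha_apply_of h', alpha_apply_of h', Pi.mul_apply]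
    by_cases hh : E.theta g⁻¹ ξ ∈ E.dom h
    · have h'' := isTheta_theta hh
      rw [alpha_apply_of h'', alpha_apply_of (h'.trans h'')]
    · rw [D_support hr' hh, zero_mul, zero_mul]
  · rw [Pi.mul_apply, alpha_apply_not hg, alpha_apply_not hg, zero_mul]

theorem skewMul_smul (c : K) (p q : FreeGroup A →₀ (E.BoundaryPath → K)) :
    skewMul K E p (c • q) = c • skewMul K E p q := by
  induction p using Finsupp.induction_linear with
  | zero => simp only [zero_skewMul, smul_zero]
  | add p p' h h' => simp only [skewMul_add_left, h, h', smul_add]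
  | single g r =>
    induction q using Finsupp.induction_linear with
    | zero => simp only [skewMul_zero, smul_zero]
    | add p p' h h' => simp only [skewMul_add, h, h', smul_add]
    | single h r' =>
      rw [Finsupp.smul_single, skewMul_single, skewMul_single, Finsupp.smul_single, mul_smul_comm,
        alpha_smul]

theorem smul_skewMul (c : K) (p q : FreeGroup A →₀ (E.BoundaryPath → K)) :
    skewMul K E (c • p) q = c • skewMul K E p q := by
  induction p using Finsupp.induction_linear with
  | zero => simp only [zero_skewMul, smul_zero]
  | add p p' h h' => simp only [skewMul_add_left, h, h', smul_add]
  | single g r =>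
    induction q using Finsupp.induction_linear with
    | zero => simp only [skewMul_zero, smul_zero]
    | add p p' h h' => simp only [skewMul_add, h, h', smul_add]
    | single h r' =>
      rw [Finsupp.smul_single, skewMul_single, skewMul_single, Finsupp.smul_single, alpha_smul,
        smul_mul_assoc, alpha_smul]

noncomputable instance : NonUnitalRing (Skew K E) where
  mul p q := ⟨skewMul K E p q, skewMul_mem p.2 q.2⟩
  left_distrib p q s := Subtype.ext (skewMul_add p.1 q.1 s.1)
  right_distrib p q s := Subtype.ext (skewMul_add_left p.1 q.1 s.1)
  zero_mul p := Subtype.ext (zero_skewMul p.1)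
  mul_zero p := Subtype.ext (skewMul_zero p.1)
  mul_assoc p q s := Subtype.ext (skewMul_assoc p.2 q.2 s.2)

theorem skew_coe_mul (p q : Skew K E) : (p * q : Skew K E).1 = skewMul K E p.1 q.1 := rfl

instance : IsScalarTower K (Skew K E) (Skew K E) :=
  ⟨fun c p q => Subtype.ext (smul_skewMul c p.1 q.1)⟩

instance : SMulCommClass K (Skew K E) (Skew K E) :=
  ⟨fun c p q => Subtype.ext (skewMul_smul c p.1 q.1).symm⟩

theorem oneG_mem_D (g : FreeGroup A) (hg : g ≠ 1) : oneG K E g ∈ D K E g := by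
  have := mem_D (g := g) (oneG_mem (K := K) (E := E) hg)
  have h2 : oneG K E g * oneG K E g = oneG K E g := by
    funext ξ; by_cases h : ξ ∈ E.dom g <;> simp [oneG, h]
  rwa [h2] at this

theorem oneV_mem_D (x : V) : oneV K E x ∈ D K E 1 := by
  have := mem_D (g := 1) (oneV_mem (K := K) (E := E) x)
  rwa [oneG_one, one_mul] at this

variable (K E)

/-- The element `r δ_g`, for `r ∈ D_g`. -/
noncomputable def delta (g : FreeGroup A) (r : E.BoundaryPath → K) (hr : r ∈ D K E g) :
    Skew K E :=
  ⟨Finsupp.single g r, fun k => by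
    classical
    rw [Finsupp.single_apply]
    split_ifs with e
    · rwa [← e]
    · exact Submodule.zero_mem _⟩

/-- The values of the isomorphism on the generators: `x ↦ 1_x δ_1`, `f ↦ 1_f δ_f`,
`f* ↦ 1_{f⁻¹} δ_{f⁻¹}`. -/
noncomputable def phiGen : Gen V A → Skew K E
  | .vert x => delta K E 1 (oneV K E x) (oneV_mem_D x)
  | .edge f => delta K E (FreeGroup.of f) (oneG K E (FreeGroup.of f))
      (oneG_mem_D _ (FreeGroup.of_ne_one f))
  | .ghost f => delta K E (FreeGroup.of f)⁻¹ (oneG K E (FreeGroup.of f)⁻¹)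
      (oneG_mem_D _ (inv_ne_one.2 (FreeGroup.of_ne_one f)))

end SkewRing

/-! ### The isomorphism `φ : L_K(E) → D(X) ⋆ 𝔽` and the induced grading -/

section Phi

variable {E : DirGraph V A}

theorem delta_mul (g h : FreeGroup A) (r r' : E.BoundaryPath → K) (hr : r ∈ D K E g)
    (hr' : r' ∈ D K E h) : (delta K E g r hr * delta K E h r' hr').1 =
      Finsupp.single (g * h) (r * alpha K E g r') := by
  rw [skew_coe_mul]
  change skewMul K E (Finsupp.single g r) (Finsupp.single h r') = _
  rw [skewMul_single, mulCoeff, D_indicator hr]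

theorem oneG_mul_self (g : FreeGroup A) : oneG K E g * oneG K E g = oneG K E g := by
  funext ξ; by_cases h : ξ ∈ E.dom g <;> simp [oneG, h]

theorem oneG_inv_of (f : A) : oneG K E (FreeGroup.of f)⁻¹ = oneV K E (E.rng f) := by
  unfold oneG oneV
  congr 1
  ext ξ
  exact mem_dom_of_inv

theorem liftMagma_gen {S : Type*} [NonUnitalRing S] [Module K S]
    [IsScalarTower K S S] [SMulCommClass K S S] (F : Gen V A → S) (t : Gen V A) :
    MonoidAlgebra.liftMagma K (FreeSemigroup.lift F) (gen K t) = F t := by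
  simp [gen]

theorem phiGen_rel (p q : FreeAlg K V A) (h : Rel K E p q) :
    MonoidAlgebra.liftMagma K (FreeSemigroup.lift (phiGen K E)) p =
      MonoidAlgebra.liftMagma K (FreeSemigroup.lift (phiGen K E)) q := by
  induction h with
  | idem x =>
    simp only [map_mul, liftMagma_gen, phiGen]
    refine Subtype.ext ?_
    rw [delta_mul, alpha_one, mul_one]
    change _ = Finsupp.single _ _
    congr 1
    funext ξ; by_cases h : ξ.source = x <;> simp [oneV, h]
  | orth x y hxy =>
    simp only [map_mul, liftMagma_gen, phiGen, map_zero]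
    refine Subtype.ext ?_
    rw [delta_mul, alpha_one, mul_one]
    change _ = (0 : FreeGroup A →₀ (E.BoundaryPath → K))
    rw [Finsupp.single_eq_zero]
    funext ξ
    by_cases h : ξ.source = x
    · simp [oneV, h, hxy]
    · simp [oneV, h]
  | src_edge f =>
    simp only [map_mul, liftMagma_gen, phiGen]
    refine Subtype.ext ?_
    rw [delta_mul, alpha_one, one_mul]
    change _ = Finsupp.single _ _
    congr 1
    funext ξ
    by_cases h : ξ ∈ E.dom (FreeGroup.of f)
    · have := (ξ.step 0 f (mem_dom_of.1 h)).1
      simp [oneV, oneG, h, source, this]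
    · simp [oneG, h]
  | edge_rng f =>
    simp only [map_mul, liftMagma_gen, phiGen]
    refine Subtype.ext ?_
    rw [delta_mul, mul_one, ← oneG_inv_of, alpha_oneG, mul_inv_cancel, oneG_one, mul_one,
      oneG_mul_self]
    rfl
  | rng_ghost f =>
    simp only [map_mul, liftMagma_gen, phiGen]
    refine Subtype.ext ?_
    rw [delta_mul, one_mul, ← oneG_inv_of, alpha_one, oneG_mul_self]
    rfl
  | ghost_src f =>
    simp only [map_mul, liftMagma_gen, phiGen]
    refine Subtype.ext ?_
    rw [delta_mul, mul_one]
    change _ = Finsupp.single _ _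
    congr 1
    funext ξ
    by_cases h : ξ ∈ E.dom (FreeGroup.of f)⁻¹
    · have h' := isTheta_theta h
      rw [Pi.mul_apply, alpha_apply_of h']
      have h1 := (isTheta_of_inv.1 h').1
      have h2 := (BoundaryPath.step _ 0 f h1).1
      simp only [inv_inv] at h2
      simp [oneV, oneG, h, source, h2]
    · simp [oneG, h]
  | ghost_edge_same f =>
    simp only [map_mul, liftMagma_gen, phiGen]
    refine Subtype.ext ?_
    rw [delta_mul, alpha_oneG, inv_mul_cancel, oneG_one, mul_one, oneG_mul_self, oneG_inv_of]
    rfl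
  | ghost_edge_ne f f' hf =>
    simp only [map_mul, liftMagma_gen, phiGen, map_zero]
    refine Subtype.ext ?_
    rw [delta_mul]
    change _ = (0 : FreeGroup A →₀ (E.BoundaryPath → K))
    rw [Finsupp.single_eq_zero]
    funext ξ
    by_cases h : ξ ∈ E.dom (FreeGroup.of f)⁻¹
    · have h' := isTheta_theta h
      rw [Pi.mul_apply, alpha_apply_of h']
      have h1 := (isTheta_of_inv.1 h').1
      have h2 : E.theta (FreeGroup.of f)⁻¹⁻¹ ξ ∉ E.dom (FreeGroup.of f') := fun hc => by
        rw [mem_dom_of, h1] at hc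
        exact hf (Option.some.inj hc)
      rw [oneG, oneG, Set.indicator_of_notMem h2, mul_zero]; rfl
    · simp [oneG, h]
  | sum_eq x hfin hne =>
    simp only [map_sum, map_mul, liftMagma_gen, phiGen]
    refine Subtype.ext ?_
    rw [Submodule.coe_sum]
    simp only [delta_mul, alpha_oneG, mul_inv_cancel, oneG_one, mul_one, oneG_mul_self]
    change Finsupp.single _ _ = _
    rw [← Finsupp.single_finsetSum]
    congr 1
    funext ξ
    rw [Finset.sum_apply]
    by_cases h : ξ.source = x
    · cases hξ : ξ.edge 0 with
      | none =>
        obtain ⟨f, hf⟩ := hne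
        exact absurd (hf.trans h.symm) ((ξ.sink_end 0 hξ).1 f)
      | some f =>
        have hs : E.src f = x := (ξ.step 0 f hξ).1.trans h
        rw [Finset.sum_eq_single f]
        · simp [oneV, oneG, h, mem_dom_of, hξ]
        · intro f' _ hf'
          have : ξ ∉ E.dom (FreeGroup.of f') := fun hc => by
            rw [mem_dom_of, hξ] at hc
            exact hf' (Option.some.inj hc).symm
          simp [oneG, this]
        · intro hc; exact absurd (by simpa using hs) hc
    · rw [Finset.sum_eq_zero]
      · simp [oneV, h]
      · intro f hf
        have hf' : E.src f = x := by simpa using hf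
        have : ξ ∉ E.dom (FreeGroup.of f) := fun hc =>
          h ((ξ.step 0 f (mem_dom_of.1 hc)).1.symm.trans hf')
        simp [oneG, this]

variable (K E) in
/-- The homomorphism `φ : L_K(E) → D(X) ⋆ 𝔽` with `φ(x) = 1_x δ_1`, `φ(f) = 1_f δ_f` and
`φ(f*) = 1_{f⁻¹} δ_{f⁻¹}`. -/
noncomputable def phi : LPA K E →ₙₐ[K] Skew K E := LPA.lift E (phiGen K E) phiGen_rel

theorem phi_gen (t : Gen V A) : phi K E (toLPA E (gen K t)) = phiGen K E t :=
  LPA.lift_gen E _ _ t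

variable (K E) in
/-- The subgroup `D_g δ_g` of `D(X) ⋆ 𝔽`. -/
def component (g : FreeGroup A) : AddSubgroup (Skew K E) where
  carrier := {p | ∀ h, h ≠ g → p.1 h = 0}
  add_mem' hp hq h hh := by simp [hp h hh, hq h hh]
  zero_mem' h _ := rfl
  neg_mem' hp h hh := by simp [hp h hh]

variable (K E) in
/-- The grading of `L_K(E)` by the free group on the edges that is induced by `φ`:
`L_K(E)_g = φ⁻¹(D_g δ_g)`. -/
noncomputable def grading (g : FreeGroup A) : AddSubgroup (LPA K E) :=
  (component K E g).comap (phi K E : LPA K E →+ Skew K E)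

end Phi

/-! ### `φ` is injective, and the family `L_K(E)_g` is a grading -/

section Injective

variable {E : DirGraph V A}

variable (K E) in
/-- A vertex, as an element of `L_K(E)`. -/
noncomputable def vx (x : V) : LPA K E := toLPA E (gen K (.vert x))

variable (K E) in
/-- An edge, as an element of `L_K(E)`. -/
noncomputable def ed (f : A) : LPA K E := toLPA E (gen K (.edge f))

variable (K E) in
/-- A ghost edge, as an element of `L_K(E)`. -/
noncomputable def gh (f : A) : LPA K E := toLPA E (gen K (.ghost f))

theorem LPA.induction {P : LPA K E → Prop} (hv : ∀ x, P (vx K E x)) (he : ∀ f, P (ed K E f))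
    (hg : ∀ f, P (gh K E f)) (h0 : P 0) (hadd : ∀ y z, P y → P z → P (y + z))
    (hsmul : ∀ (c : K) y, P y → P (c • y)) (hmul : ∀ y z, P y → P z → P (y * z))
    (y : LPA K E) : P y := by
  obtain ⟨p, rfl⟩ := toLPA_surjective E y
  induction p using MonoidAlgebra.induction_linear with
  | zero => exact h0
  | add p q hp hq => exact hadd _ _ hp hq
  | single w c =>
    have key : P (toLPA E (MonoidAlgebra.single w 1)) := by
      induction w using FreeSemigroup.recOnMul with
      | ih1 t => cases t with
        | vert x => exact hv x
        | edge f => exact he f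
        | ghost f => exact hg f
      | ih2 t w ht hw =>
        have := hmul _ _ ht hw
        rwa [← toLPA_mul, MonoidAlgebra.single_mul_single, mul_one] at this
    have := hsmul c _ key
    rwa [← toLPA_smul, MonoidAlgebra.smul_single, smul_eq_mul, mul_one] at this

theorem vx_mul_self (x : V) : vx K E x * vx K E x = vx K E x := toLPA_rel E (.idem x)
theorem vx_mul_ne {x y : V} (h : x ≠ y) : vx K E x * vx K E y = 0 := toLPA_rel E (.orth x y h)
theorem vx_ed (f : A) : vx K E (E.src f) * ed K E f = ed K E f := toLPA_rel E (.src_edge f)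
theorem ed_vx (f : A) : ed K E f * vx K E (E.rng f) = ed K E f := toLPA_rel E (.edge_rng f)
theorem vx_gh (f : A) : vx K E (E.rng f) * gh K E f = gh K E f := toLPA_rel E (.rng_ghost f)
theorem gh_vx (f : A) : gh K E f * vx K E (E.src f) = gh K E f := toLPA_rel E (.ghost_src f)
theorem gh_ed (f : A) : gh K E f * ed K E f = vx K E (E.rng f) := toLPA_rel E (.ghost_edge_same f)
theorem gh_ed_ne {f f' : A} (h : f ≠ f') : gh K E f * ed K E f' = 0 :=
  toLPA_rel E (.ghost_edge_ne f f' h)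

theorem vx_ed_ne {x : V} {f : A} (h : x ≠ E.src f) : vx K E x * ed K E f = 0 := by
  rw [← vx_ed, ← mul_assoc, vx_mul_ne h, zero_mul]
theorem ed_vx_ne {x : V} {f : A} (h : E.rng f ≠ x) : ed K E f * vx K E x = 0 := by
  rw [← ed_vx, mul_assoc, vx_mul_ne h, mul_zero]
theorem gh_vx_ne {x : V} {f : A} (h : E.src f ≠ x) : gh K E f * vx K E x = 0 := by
  rw [← gh_vx, mul_assoc, vx_mul_ne h, mul_zero]

theorem vx_eq_sum (x : V) (hfin : {f | E.src f = x}.Finite) (hne : {f | E.src f = x}.Nonempty) :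
    vx K E x = ∑ f ∈ hfin.toFinset, ed K E f * gh K E f := by
  have h := toLPA_rel (K := K) E (.sum_eq x hfin hne)
  let q : FreeAlg K V A →+ LPA K E := ⟨⟨toLPA E, toLPA_zero E⟩, toLPA_add E⟩
  change q _ = q _ at h
  rw [map_sum] at h
  exact h

/-- Left multiplication by a word in the edges. -/
noncomputable def lft (a : List A) (z : LPA K E) : LPA K E := a.foldr (fun f z => ed K E f * z) z

/-- Right multiplication by `b*`. -/
noncomputable def rgt (b : List A) (z : LPA K E) : LPA K E := b.foldr (fun f z => z * gh K E f) z

variable (K E) in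
/-- The monomial `a x b*`. -/
noncomputable def mon (a : List A) (x : V) (b : List A) : LPA K E := lft a (rgt b (vx K E x))

theorem lft_mul (a : List A) (z y : LPA K E) : lft a (z * y) = lft a z * y := by
  induction a with
  | nil => rfl
  | cons f a ih => simp only [lft, List.foldr_cons] at ih ⊢; rw [ih, mul_assoc]

theorem lft_zero (a : List A) : lft a (0 : LPA K E) = 0 := by
  have := lft_mul a (0 : LPA K E) 0
  simpa using this

theorem mul_rgt (b : List A) (z y : LPA K E) : rgt b (z * y) = z * rgt b y := by
  induction b with
  | nil => rfl
  | cons f a ih => simp only [rgt, List.foldr_cons] at ih ⊢; rw [ih, mul_assoc]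

theorem rgt_zero (b : List A) : rgt b (0 : LPA K E) = 0 := by
  have := mul_rgt b (0 : LPA K E) 0
  simpa using this

theorem mon_cons (f : A) (a : List A) (x : V) (b : List A) :
    mon K E (f :: a) x b = ed K E f * mon K E a x b := rfl

theorem mon_ghost (a : List A) (x : V) (f : A) (b : List A) :
    mon K E a x (f :: b) = mon K E a x b * gh K E f := by
  rw [mon, mon, ← lft_mul]; rfl

theorem vx_mon (y : V) (a : List A) (x : V) (b : List A) :
    vx K E y * mon K E a x b = 0 ∨ vx K E y * mon K E a x b = mon K E a x b := by
  cases a with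
  | nil =>
    change vx K E y * rgt b _ = _ ∨ vx K E y * rgt b _ = rgt b _
    rw [← mul_rgt]
    rcases eq_or_ne y x with rfl | h
    · right; rw [vx_mul_self]
    · left; rw [vx_mul_ne h, rgt_zero]
  | cons f a =>
    rw [mon_cons, ← mul_assoc]
    rcases eq_or_ne y (E.src f) with rfl | h
    · right; rw [vx_ed]
    · left; rw [vx_ed_ne h, zero_mul]

/-- A vertex that fixes the monomial on the right. -/
def monSrc (E : DirGraph V A) (x : V) : List A → V
  | [] => x
  | f :: _ => E.src f

theorem mon_vx (a : List A) (x : V) (b : List A) :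
    mon K E a x b * vx K E (E.monSrc x b) = mon K E a x b := by
  cases b with
  | nil => change lft a (vx K E x) * vx K E x = lft a (vx K E x); rw [← lft_mul, vx_mul_self]
  | cons f b => rw [mon_ghost, mul_assoc]; simp only [monSrc]; rw [gh_vx]

theorem mon_vx_ne (a : List A) (x : V) (b : List A) {y : V} (h : E.monSrc x b ≠ y) :
    mon K E a x b * vx K E y = 0 := by
  rw [← mon_vx, mul_assoc, vx_mul_ne h, mul_zero]

variable (K E) in
/-- The span of the monomials `a x b*` with `|b| ≤ n`. -/
noncomputable def Sn (n : ℕ) : Submodule K (LPA K E) :=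
  Submodule.span K {z | ∃ a x b, b.length ≤ n ∧ z = mon K E a x b}

theorem mon_mem_Sn {n : ℕ} {a : List A} {x : V} {b : List A} (h : b.length ≤ n) :
    mon K E a x b ∈ Sn K E n := Submodule.subset_span ⟨a, x, b, h, rfl⟩

theorem mon_mem_span (y : LPA K E) :
    y ∈ Submodule.span K {z | ∃ a x b, z = mon K E a x b} := by
  set T := Submodule.span K {z | ∃ a x b, z = mon K E a x b} with hT
  have hmon : ∀ a x b, mon K E a x b ∈ T := fun a x b => Submodule.subset_span ⟨a, x, b, rfl⟩
  have hvm : ∀ y a x b, vx K E y * mon K E a x b ∈ T := fun y a x b => by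
    rcases vx_mon (K := K) (E := E) y a x b with h | h <;> rw [h]
    · exact T.zero_mem
    · exact hmon _ _ _
  have lin : ∀ t : LPA K E, (∀ a x b, t * mon K E a x b ∈ T) → ∀ z ∈ T, t * z ∈ T := by
    intro t ht z hz
    induction hz using Submodule.span_induction with
    | mem z h => obtain ⟨a, x, b, rfl⟩ := h; exact ht a x b
    | zero => rw [mul_zero]; exact T.zero_mem
    | add _ _ _ _ h1 h2 => rw [mul_add]; exact T.add_mem h1 h2
    | smul c _ _ h => rw [mul_smul_comm]; exact T.smul_mem c h
  have main : y ∈ T ∧ ∀ z ∈ T, y * z ∈ T := by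
    refine LPA.induction (P := fun y => y ∈ T ∧ ∀ z ∈ T, y * z ∈ T) (fun x => ⟨hmon [] x [], ?_⟩)
      (fun f => ⟨?_, ?_⟩) (fun f => ⟨?_, ?_⟩) ⟨T.zero_mem, fun z _ => ?_⟩ (fun y y' h h' =>
      ⟨T.add_mem h.1 h'.1, fun z hz => ?_⟩) (fun c y h => ⟨T.smul_mem c h.1, fun z hz => ?_⟩)
      (fun y y' h h' => ⟨h.2 _ h'.1, fun z hz => ?_⟩) y
    · exact lin _ (hvm x)
    · rw [← ed_vx]; exact hmon [f] (E.rng f) []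
    · exact lin _ fun a x b => hmon (f :: a) x b
    · rw [← vx_gh]; exact hmon [] (E.rng f) [f]
    · refine lin _ fun a x b => ?_
      cases a with
      | nil =>
        change gh K E f * rgt b _ ∈ T
        rw [← mul_rgt]
        rcases eq_or_ne (E.src f) x with rfl | h
        · rw [gh_vx, ← vx_gh]
          have : mon K E [] (E.rng f) (b ++ [f]) = rgt b (vx K E (E.rng f) * gh K E f) := by
            simp [mon, lft, rgt]
          rw [← this]; exact hmon _ _ _
        · rw [gh_vx_ne h, rgt_zero]; exact T.zero_mem
      | cons f' a =>
        rw [mon_cons, ← mul_assoc]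
        rcases eq_or_ne f f' with rfl | h
        · rw [gh_ed]; exact hvm _ _ _ _
        · rw [gh_ed_ne h, zero_mul]; exact T.zero_mem
    · rw [zero_mul]; exact T.zero_mem
    · rw [add_mul]; exact T.add_mem (h.2 z hz) (h'.2 z hz)
    · rw [smul_mul_assoc]; exact T.smul_mem c (h.2 z hz)
    · rw [mul_assoc]; exact h.2 _ (h'.2 z hz)
  exact main.1

theorem mem_Sn (y : LPA K E) : ∃ n, y ∈ Sn K E n := by
  have hmono : ∀ {m n : ℕ}, m ≤ n → Sn K E m ≤ Sn K E n := fun h => Submodule.span_mono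
    fun z ⟨a, x, b, hb, hz⟩ => ⟨a, x, b, hb.trans h, hz⟩
  induction mon_mem_span y using Submodule.span_induction with
  | mem z h => obtain ⟨a, x, b, rfl⟩ := h; exact ⟨_, mon_mem_Sn le_rfl⟩
  | zero => exact ⟨0, Submodule.zero_mem _⟩
  | add _ _ _ _ h1 h2 =>
    obtain ⟨m, hm⟩ := h1
    obtain ⟨n, hn⟩ := h2
    exact ⟨max m n, Submodule.add_mem _ (hmono (le_max_left _ _) hm) (hmono (le_max_right _ _) hn)⟩
  | smul c _ _ h => obtain ⟨n, hn⟩ := h; exact ⟨n, Submodule.smul_mem _ c hn⟩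

theorem eq_zero_of_mul_vx {y : LPA K E} (h : ∀ x, y * vx K E x = 0) : y = 0 := by
  classical
  have key : ∃ F : Finset V, ∀ G : Finset V, F ⊆ G → ∑ x ∈ G, y * vx K E x = y := by
    clear h
    induction mon_mem_span y using Submodule.span_induction with
    | mem z h =>
      obtain ⟨a, x, b, rfl⟩ := h
      refine ⟨{E.monSrc x b}, fun G hG => ?_⟩
      rw [Finset.sum_eq_single (E.monSrc x b), mon_vx]
      · intro y _ hy; exact mon_vx_ne _ _ _ hy.symm
      · intro hc; exact absurd (hG (by simp)) hc
    | zero => exact ⟨∅, fun G _ => by simp⟩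
    | add y z _ _ h1 h2 =>
      obtain ⟨F, hF⟩ := h1
      obtain ⟨F', hF'⟩ := h2
      refine ⟨F ∪ F', fun G hG => ?_⟩
      simp only [add_mul, Finset.sum_add_distrib]
      rw [hF G (Finset.union_subset_left hG), hF' G (Finset.union_subset_right hG)]
    | smul c y _ h =>
      obtain ⟨F, hF⟩ := h
      refine ⟨F, fun G hG => ?_⟩
      simp only [smul_mul_assoc, ← Finset.smul_sum]
      rw [hF G hG]
  obtain ⟨F, hF⟩ := key
  rw [← hF F subset_rfl]
  exact Finset.sum_eq_zero fun x _ => h x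

theorem Sn_mul_ed {n : ℕ} {y : LPA K E} (hy : y ∈ Sn K E (n + 1)) (f : A) :
    y * ed K E f ∈ Sn K E n := by
  induction hy using Submodule.span_induction with
  | mem z h =>
    obtain ⟨a, x, b, hb, rfl⟩ := h
    cases b with
    | nil =>
      change lft a (vx K E x) * ed K E f ∈ _
      rw [← lft_mul]
      rcases eq_or_ne x (E.src f) with rfl | h
      · rw [vx_ed, ← ed_vx]
        have : mon K E (a ++ [f]) (E.rng f) [] = lft a (ed K E f * vx K E (E.rng f)) := by
          simp [mon, lft, rgt]
        rw [← this]; exact mon_mem_Sn (by simp)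
      · rw [vx_ed_ne h, lft_zero]; exact Submodule.zero_mem _
    | cons f' b =>
      rw [mon_ghost, mul_assoc]
      rcases eq_or_ne f' f with rfl | h
      · rw [gh_ed]
        rcases eq_or_ne (E.monSrc x b) (E.rng f') with h | h
        · rw [← h, mon_vx]; exact mon_mem_Sn (by simpa using hb)
        · rw [mon_vx_ne _ _ _ h]; exact Submodule.zero_mem _
      · rw [gh_ed_ne h, mul_zero]; exact Submodule.zero_mem _
  | zero => rw [zero_mul]; exact Submodule.zero_mem _
  | add _ _ _ _ h1 h2 => rw [add_mul]; exact Submodule.add_mem _ h1 h2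
  | smul c _ _ h => rw [smul_mul_assoc]; exact Submodule.smul_mem _ c h

/-- Every vertex is the source of a boundary path. -/
theorem exists_boundaryPath (E : DirGraph V A) (x : V) : ∃ ζ : E.BoundaryPath, ζ.source = x := by
  classical
  let nxt : V → V := fun y => if h : ∃ f, E.src f = y then E.rng h.choose else y
  refine ⟨⟨fun n => nxt^[n] x,
    fun n => if h : ∃ f, E.src f = nxt^[n] x then some h.choose else none, ?_, ?_⟩, rfl⟩
  · intro n f hf
    split_ifs at hf with h
    · cases hf
      refine ⟨h.choose_spec, ?_⟩
      rw [Function.iterate_succ_apply']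
      simp only [nxt]
      rw [dif_pos h]
  · intro n hf
    split_ifs at hf with h
    refine ⟨fun f hc => h ⟨f, hc⟩, ?_⟩
    rw [Function.iterate_succ_apply']
    simp only [nxt]
    rw [dif_neg h]

theorem phi_vx (x : V) : phi K E (vx K E x) = delta K E 1 (oneV K E x) (oneV_mem_D x) := phi_gen _

theorem phi_ed (f : A) : phi K E (ed K E f) = delta K E (FreeGroup.of f)
    (oneG K E (FreeGroup.of f)) (oneG_mem_D _ (FreeGroup.of_ne_one f)) := phi_gen _

theorem phi_gh (f : A) : phi K E (gh K E f) = delta K E (FreeGroup.of f)⁻¹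
    (oneG K E (FreeGroup.of f)⁻¹) (oneG_mem_D _ (inv_ne_one.2 (FreeGroup.of_ne_one f))) := phi_gen _

theorem phi_mon (a : List A) (x : V) : (phi K E (mon K E a x [])).1 =
    Finsupp.single (pos a) ({ξ | HasPrefix a ξ ∧ ξ.vert a.length = x}.indicator 1) := by
  classical
  induction a with
  | nil =>
    change (phi K E (vx K E x)).1 = _
    rw [phi_vx]
    change Finsupp.single _ _ = _
    rw [pos_nil]
    congr 1
    unfold oneV
    congr 1
    ext ξ
    simp [hasPrefix_nil, source]
  | cons f a ih =>
    rw [mon_cons, map_mul, phi_ed, skew_coe_mul, ih]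
    change skewMul K E (Finsupp.single _ _) _ = _
    rw [skewMul_single, mulCoeff, D_indicator (oneG_mem_D _ (FreeGroup.of_ne_one f)),
      ← List.singleton_append, pos_append, pos_singleton]
    congr 1
    funext ξ
    by_cases h : ξ ∈ E.dom (FreeGroup.of f)
    · have h1 := mem_dom_of.1 h
      rw [Pi.mul_apply, alpha_apply_of (isTheta_of_edge.2 ⟨h1, rfl⟩)]
      simp only [oneG, Set.indicator_apply, h, if_true, Set.mem_ofPred_eq, hasPrefix_append,
        hasPrefix_singleton, h1, true_and, one_mul, Pi.one_apply, List.length_append,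
        List.length_singleton]
      rfl
    · have h1 : ¬ ξ.edge 0 = some f := fun hc => h (mem_dom_of.2 hc)
      rw [Pi.mul_apply, alpha_apply_not h, mul_zero, Set.indicator_of_notMem]
      rintro ⟨hc, -⟩
      exact h1 (hasPrefix_singleton.1 (hasPrefix_append.1 hc).1)

theorem mon_eq_zero (a : List A) (x : V) (h : ¬ E.IsPathTo a x) : mon K E a x [] = 0 := by
  induction a with
  | nil => exact absurd ⟨List.isChain_nil, by simp⟩ h
  | cons f a ih =>
    rw [mon_cons]
    cases a with
    | nil =>
      refine ed_vx_ne fun hc => h ⟨List.isChain_singleton _, ?_⟩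
      intro f' hf'
      obtain rfl : f = f' := by simpa using hf'
      exact hc
    | cons f' a =>
      by_cases ha : E.IsPathTo (f' :: a) x
      · rw [mon_cons, ← mul_assoc]
        have : E.rng f ≠ E.src f' := fun hc =>
          h ⟨List.isChain_cons_cons.2 ⟨hc, ha.1⟩, by
            rw [List.getLast?_cons_cons]; exact ha.2⟩
        rw [← vx_ed f', ← mul_assoc, ed_vx_ne this, zero_mul, zero_mul]
      · rw [ih ha, mul_zero]

theorem eq_zero_of_phi_mul {x : V} {y : LPA K E}
    (hy : y ∈ Submodule.span K (Set.range fun a => mon K E a x []))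
    {h : FreeGroup A} {r : E.BoundaryPath → K} (hr : r ∈ D K E h) {ζ : E.BoundaryPath}
    (hζ : ζ.source = x) (hrζ : r ζ ≠ 0) (h0 : phi K E y * delta K E h r hr = 0) : y = 0 := by
  classical
  obtain ⟨c, rfl⟩ := Finsupp.mem_span_range_iff_exists_finsupp.1 hy
  refine Finset.sum_eq_zero fun a₀ _ => ?_
  by_cases hp : E.IsPathTo a₀ x
  · obtain ⟨ξ, hξ, hd⟩ := exists_concat a₀ ζ (by rwa [hζ])
    have hv : ξ.vert a₀.length = x := by
      rw [← hζ, ← hd]; simp [source, drop]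
    have hth : E.IsTheta (pos a₀) ζ ξ :=
      isTheta_iff.2 ⟨a₀, [], by simp [pos_nil], hasPrefix_nil _, hξ, by rw [hd]; exact
        (drop_zero _).symm⟩
    have e : (phi K E (c.sum fun a t => t • mon K E a x []) * delta K E h r hr).1 =
        c.sum fun a t => Finsupp.single (pos a * h)
          (t • ({ξ | HasPrefix a ξ ∧ ξ.vert a.length = x}.indicator 1 * alpha K E (pos a) r)) := by
      rw [Finsupp.sum, map_sum, Finset.sum_mul, Submodule.coe_sum]
      refine Finset.sum_congr rfl fun a _ => ?_
      rw [map_smul, smul_mul_assoc, Submodule.coe_smul, skew_coe_mul, phi_mon]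
      change _ • skewMul K E _ (Finsupp.single _ _) = _
      rw [skewMul_single, mulCoeff, Finsupp.smul_single, Set.indicator_eq_self.2]
      intro ξ hξ
      exact mem_dom_pos.2 (Set.mem_of_indicator_ne_zero hξ).1
    rw [h0] at e
    have e' := congrFun (DFunLike.congr_fun e (pos a₀ * h)) ξ
    rw [Finsupp.sum, Finsupp.finsetSum_apply, Finset.sum_apply, Finset.sum_eq_single a₀] at e'
    · rw [Finsupp.single_eq_same, Pi.smul_apply, Pi.mul_apply, alpha_apply_of hth,
        Set.indicator_of_mem (show ξ ∈ {ξ | HasPrefix a₀ ξ ∧ ξ.vert a₀.length = x} from ⟨hξ, hv⟩)]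
        at e'
      have : c a₀ = 0 := by
        have e'' : 0 = c a₀ * (1 * r ζ) := e'
        simpa [hrζ] using e''.symm
      simp [this]
    · intro a _ ha
      rw [Finsupp.single_eq_of_ne]
      · rfl
      · intro hc
        exact ha (pos_injective (mul_right_cancel hc)).symm
    · intro hc
      rw [Finsupp.notMem_support_iff.1 hc]; simp
  · change c a₀ • mon K E a₀ x [] = 0
    rw [mon_eq_zero a₀ x hp, smul_zero]

theorem decomp (x : V) (y : LPA K E) :
    ∃ u ∈ Submodule.span K (Set.range fun a => mon K E a x []), ∃ z : A →₀ LPA K E,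
      (∀ f, E.src f ≠ x → z f = 0) ∧ y * vx K E x = u + z.sum fun f t => t * gh K E f := by
  classical
  induction mon_mem_span y using Submodule.span_induction with
  | mem y h =>
    obtain ⟨a, w, b, rfl⟩ := h
    rcases eq_or_ne (E.monSrc w b) x with h | h
    · subst h
      rw [mon_vx]
      cases b with
      | nil => exact ⟨_, Submodule.subset_span ⟨a, rfl⟩, 0, fun _ _ => rfl, by simp [monSrc]⟩
      | cons f b =>
        refine ⟨0, Submodule.zero_mem _, Finsupp.single f (mon K E a w b), fun f' hf' => ?_, ?_⟩
        · rw [Finsupp.single_eq_of_ne]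
          rintro rfl
          exact hf' rfl
        · rw [Finsupp.sum_single_index (zero_mul _), zero_add, mon_ghost]
    · exact ⟨0, Submodule.zero_mem _, 0, fun _ _ => rfl, by rw [mon_vx_ne _ _ _ h]; simp⟩
  | zero => exact ⟨0, Submodule.zero_mem _, 0, fun _ _ => rfl, by simp⟩
  | add y y' _ _ h h' =>
    obtain ⟨u, hu, z, hz, e⟩ := h
    obtain ⟨u', hu', z', hz', e'⟩ := h'
    refine ⟨u + u', Submodule.add_mem _ hu hu', z + z', fun f hf => ?_, ?_⟩
    · simp [hz f hf, hz' f hf]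
    · rw [Finsupp.sum_add_index' (fun _ => zero_mul _) (fun _ _ _ => add_mul _ _ _), add_mul, e, e']
      abel
  | smul c y _ h =>
    obtain ⟨u, hu, z, hz, e⟩ := h
    refine ⟨c • u, Submodule.smul_mem _ c hu, c • z, fun f hf => ?_, ?_⟩
    · simp [hz f hf]
    · rw [Finsupp.sum_smul_index' (fun _ => zero_mul _), smul_mul_assoc, e, smul_add,
        Finsupp.smul_sum]
      simp only [smul_mul_assoc]

theorem oneV_apply {x : V} {ζ : E.BoundaryPath} (h : ζ.source = x) : oneV K E x ζ ≠ 0 := by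
  simp [oneV, h]

theorem phi_injective_aux (n : ℕ) :
    ∀ y ∈ Sn K E n, phi K E y = 0 → y = 0 := by
  classical
  induction n with
  | zero =>
    intro y hy h0
    refine eq_zero_of_mul_vx fun x => ?_
    obtain ⟨ζ, hζ⟩ := exists_boundaryPath E x
    refine eq_zero_of_phi_mul (x := x) ?_ (oneV_mem_D x) hζ (oneV_apply hζ)
      (by rw [map_mul, h0, zero_mul, zero_mul])
    clear h0
    induction hy using Submodule.span_induction with
    | mem z h =>
      obtain ⟨a, w, b, hb, rfl⟩ := h
      obtain rfl : b = [] := by simpa using hb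
      rcases eq_or_ne w x with rfl | h
      · have := mon_vx (K := K) (E := E) a w []
        simp only [monSrc] at this
        rw [this]; exact Submodule.subset_span ⟨a, rfl⟩
      · rw [mon_vx_ne a w [] h]; exact Submodule.zero_mem _
    | zero => rw [zero_mul]; exact Submodule.zero_mem _
    | add _ _ _ _ h1 h2 => rw [add_mul]; exact Submodule.add_mem _ h1 h2
    | smul c _ _ h => rw [smul_mul_assoc]; exact Submodule.smul_mem _ c h
  | succ n ih =>
    intro y hy h0
    have hye : ∀ f, y * ed K E f = 0 := fun f =>
      ih _ (Sn_mul_ed hy f) (by rw [map_mul, h0, zero_mul])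
    refine eq_zero_of_mul_vx fun x => ?_
    obtain ⟨u, hu, z, hz, e⟩ := decomp x y
    have hmul : ∀ f, E.src f = x → y * ed K E f = u * ed K E f + z f * vx K E (E.rng f) := by
      intro f hf
      have : y * ed K E f = y * vx K E x * ed K E f := by rw [mul_assoc, ← hf, vx_ed]
      rw [this, e, add_mul, Finsupp.sum_mul, Finsupp.sum, Finset.sum_eq_single f]
      · rw [mul_assoc, gh_ed]
      · intro f' _ hf'
        rw [mul_assoc, gh_ed_ne hf', mul_zero]
      · intro hc
        rw [Finsupp.notMem_support_iff.1 hc, zero_mul, zero_mul]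
    by_cases hnew : ∃ f, E.src f = x ∧ z f = 0
    · obtain ⟨f, hf, hzf⟩ := hnew
      have hu0 : u = 0 := by
        obtain ⟨ζ, hζ⟩ := exists_boundaryPath E (E.rng f)
        have hedge : (ζ.cons f hζ.symm) ∈ E.dom (FreeGroup.of f) := mem_dom_of.2 rfl
        refine eq_zero_of_phi_mul hu (oneG_mem_D _ (FreeGroup.of_ne_one f))
          (ζ := ζ.cons f hζ.symm) hf (by simp [oneG, hedge]) ?_
        rw [← phi_ed, ← map_mul]
        have := hmul f hf
        rw [hzf, zero_mul, add_zero] at this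
        rw [← this, hye, map_zero]
      rw [e, hu0, zero_add]
      refine Finset.sum_eq_zero fun f' hf' => ?_
      have hs : E.src f' = x := by
        by_contra hc
        exact (Finsupp.mem_support_iff.1 hf') (hz f' hc)
      have h1 := hmul f' hs
      rw [hye, hu0, zero_mul, zero_add] at h1
      change z f' * gh K E f' = 0
      rw [← vx_gh, ← mul_assoc, ← h1, zero_mul]
    · push Not at hnew
      have hfin : {f | E.src f = x}.Finite :=
        z.support.finite_toSet.subset fun f hf => Finsupp.mem_support_iff.2 (hnew f hf)
      rcases {f | E.src f = x}.eq_empty_or_nonempty with hemp | hne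
      · have hz0 : z = 0 := by
          ext1 f
          refine hz f fun hc => ?_
          have : f ∈ {f | E.src f = x} := hc
          rw [hemp] at this; exact this
        rw [hz0, Finsupp.sum_zero_index, add_zero] at e
        obtain ⟨ζ, hζ⟩ := exists_boundaryPath E x
        rw [e]
        refine eq_zero_of_phi_mul hu (oneV_mem_D x) hζ (oneV_apply hζ) ?_
        rw [← e, map_mul, h0, zero_mul, zero_mul]
      · rw [vx_eq_sum x hfin hne, Finset.mul_sum]
        refine Finset.sum_eq_zero fun f _ => ?_
        rw [← mul_assoc, hye, zero_mul]

theorem phi_injective : Function.Injective (phi K E) := by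
  intro y z h
  rw [← sub_eq_zero]
  obtain ⟨n, hn⟩ := mem_Sn (y - z)
  exact phi_injective_aux n _ hn (by rw [map_sub, h, sub_self])

end Injective

section IsGrading

variable {E : DirGraph V A}

theorem mem_grading {g : FreeGroup A} {y : LPA K E} :
    y ∈ grading K E g ↔ ∀ h, h ≠ g → (phi K E y).1 h = 0 := Iff.rfl

theorem delta_mem_component (g : FreeGroup A) (r : E.BoundaryPath → K) (hr : r ∈ D K E g) :
    delta K E g r hr ∈ component K E g := fun _ hh => Finsupp.single_eq_of_ne hh

theorem component_eq {g : FreeGroup A} {p : Skew K E} (hp : p ∈ component K E g) :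
    p = delta K E g (p.1 g) (p.2 g) := by
  refine Subtype.ext (Finsupp.ext fun h => ?_)
  rcases eq_or_ne h g with rfl | hh
  · exact Finsupp.single_eq_same.symm
  · rw [hp h hh]; exact (Finsupp.single_eq_of_ne hh).symm

theorem grading_mul_mem {g h : FreeGroup A} {y z : LPA K E} (hy : y ∈ grading K E g)
    (hz : z ∈ grading K E h) : y * z ∈ grading K E (g * h) := by
  change phi K E (y * z) ∈ component K E (g * h)
  rw [map_mul, component_eq (show phi K E y ∈ component K E g from hy),
    component_eq (show phi K E z ∈ component K E h from hz)]
  intro k hk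
  rw [delta_mul]
  exact Finsupp.single_eq_of_ne hk

theorem grading_isInternal [DecidableEq (FreeGroup A)] :
    DirectSum.IsInternal (grading K E) := by
  have _ : DecidableEq (LPA K E) := Classical.decEq _
  constructor
  · rw [injective_iff_map_eq_zero]
    intro y hy
    refine DFinsupp.ext fun g => Subtype.ext (phi_injective ?_)
    have e : phi K E (DirectSum.coeAddMonoidHom (grading K E) y) = 0 := by
        rw [hy, map_zero]
    rw [DirectSum.coeAddMonoidHom_eq_dfinsuppSum, DFinsupp.sum, map_sum] at e
    have e' := DFunLike.congr_fun (congrArg Subtype.val e) g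
    rw [Submodule.coe_sum, Finsupp.finsetSum_apply, Finset.sum_eq_single g] at e'
    · refine Subtype.ext (Finsupp.ext fun h => ?_)
      rcases eq_or_ne h g with rfl | hh
      · rw [e']; simp
      · exact ((y g).2 h hh).trans (by simp)
    · intro h _ hh
      exact (y h).2 g hh.symm
    · intro hc
      rw [DFinsupp.notMem_support_iff.1 hc]
      simp
  · intro y
    change y ∈ (DirectSum.coeAddMonoidHom (grading K E)).range
    have hof : ∀ {g : FreeGroup A} {y : LPA K E}, y ∈ grading K E g →
        y ∈ (DirectSum.coeAddMonoidHom (grading K E)).range := fun {g y} hy =>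
      ⟨DirectSum.of (fun g => grading K E g) g ⟨y, hy⟩, DirectSum.coeAddMonoidHom_of _ _ _⟩
    have hind : ∀ (P : LPA K E → Prop), (∀ g, ∀ y ∈ grading K E g, P y) → P 0 →
        (∀ y z, P y → P z → P (y + z)) →
        ∀ y ∈ (DirectSum.coeAddMonoidHom (grading K E)).range, P y := by
      rintro P h1 h0 h2 _ ⟨t, rfl⟩
      induction t using DirectSum.induction_on with
      | zero => rw [map_zero]; exact h0
      | of g t => rw [DirectSum.coeAddMonoidHom_of]; exact h1 g _ t.2
      | add t t' h h' => rw [map_add]; exact h2 _ _ h h'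
    refine LPA.induction
      (P := fun y => y ∈ (DirectSum.coeAddMonoidHom (grading K E)).range)
      (fun x => hof (g := 1) ?_) (fun f => hof (g := FreeGroup.of f) ?_)
      (fun f => hof (g := (FreeGroup.of f)⁻¹) ?_) (AddSubgroup.zero_mem _)
      (fun _ _ h h' => AddSubgroup.add_mem _ h h') (fun c => ?_) (fun y z hy hz => ?_) y
    · change phi K E _ ∈ component K E _; rw [phi_vx]; exact delta_mem_component _ _ _
    · change phi K E _ ∈ component K E _; rw [phi_ed]; exact delta_mem_component _ _ _
    · change phi K E _ ∈ component K E _; rw [phi_gh]; exact delta_mem_component _ _ _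
    · refine hind _ (fun g y hy => hof (g := g) fun h hh => ?_) ?_ ?_
      · change (phi K E (c • y)).1 h = 0
        rw [map_smul, Submodule.coe_smul, Finsupp.smul_apply, (mem_grading.1 hy) h hh, smul_zero]
      · rw [smul_zero]; exact AddSubgroup.zero_mem _
      · intro y z h h'; rw [smul_add]; exact AddSubgroup.add_mem _ h h'
    · revert y
      refine hind _ (fun g y hy => ?_) ?_ ?_
      · revert z
        refine hind _ (fun h z hz => hof (grading_mul_mem hy hz)) ?_ ?_
        · rw [mul_zero]; exact AddSubgroup.zero_mem _
        · intro z z' h h'; rw [mul_add]; exact AddSubgroup.add_mem _ h h'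
      · rw [zero_mul]; exact AddSubgroup.zero_mem _
      · intro z z' h h'; rw [add_mul]; exact AddSubgroup.add_mem _ h h'

variable (K E) in
/-- The family `L_K(E)_g` is a grading of `L_K(E)` by the free group on the edges. -/
theorem grading_isGrading : IsGrading (grading K E) :=
  ⟨@grading_isInternal V A K _ E (fun _ _ => Classical.propDecidable _), grading_mul_mem⟩

end IsGrading

end DirGraph


/-! For every edge `f` the idempotent `f f*` is a left identity on the component of degree `f`. If
the grading is strong, then `R_k = R_f R_{f⁻¹k}` for all `k`, so `f f*` is a left identity of the
whole algebra. If `R` is graded clean, then `f` is a unit, because nonzero homogeneous idempotents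
have degree `1`; so `f f* = f f* f f⁻¹ = f f⁻¹ = 1`. In both cases `f f* x = x ≠ 0` forces every
vertex `x` to be the source of `f`, and `f f* f' = f' ≠ 0` forces every edge `f'` to equal `f`.

Conversely, the Leavitt path algebra of a loop is the ring of Laurent polynomials in `f`, with
`f* = f⁻¹`: each of its homogeneous components contains a unit, and the component of degree `1` is
the field `K`. -/

section Graded

variable {G R : Type*} [Group G] [NonUnitalRing R] {𝓐 : G → AddSubgroup R}

namespace IsGrading

theorem iSupIndep (h𝓐 : IsGrading 𝓐) : iSupIndep 𝓐 := by
  classical exact h𝓐.isInternal.addSubgroup_iSupIndep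

theorem iSup_eq_top (h𝓐 : IsGrading 𝓐) : ⨆ g, 𝓐 g = ⊤ := by
  classical
  refine (AddSubgroup.eq_top_iff' _).2 fun x => ?_
  obtain ⟨s, rfl⟩ := h𝓐.isInternal.surjective x
  induction s using DirectSum.induction_on with
  | zero => exact map_zero (DirectSum.coeAddMonoidHom 𝓐) ▸ zero_mem _
  | of g y =>
    rw [DirectSum.coeAddMonoidHom_of]
    exact AddSubgroup.mem_iSup_of_mem g y.2
  | add s t hs ht =>
    rw [map_add]
    exact add_mem hs ht

theorem eq_zero_of_mem_of_mem (h𝓐 : IsGrading 𝓐) {g h : G} {x : R} (hg : x ∈ 𝓐 g) (hh : x ∈ 𝓐 h)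
    (hne : g ≠ h) : x = 0 :=
  AddSubgroup.disjoint_def.1 (h𝓐.iSupIndep.pairwiseDisjoint hne) hg hh

theorem add_eq_zero_or_right_eq_zero (h𝓐 : IsGrading 𝓐) {g h k : G} {x y : R} (hx : x ∈ 𝓐 h)
    (hy : y ∈ 𝓐 k) (hxy : x + y ∈ 𝓐 g) (hne : k ≠ g) : x + y = 0 ∨ y = 0 := by
  rcases eq_or_ne h g with rfl | hhg
  · exact .inr (h𝓐.eq_zero_of_mem_of_mem hy ((AddSubgroup.add_mem_cancel_left _ hx).1 hxy) hne)
  · have hsup : x + y ∈ ⨆ j ≠ g, 𝓐 j :=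
      add_mem (AddSubgroup.mem_iSup_of_mem h (AddSubgroup.mem_iSup_of_mem hhg hx))
        (AddSubgroup.mem_iSup_of_mem k (AddSubgroup.mem_iSup_of_mem hne hy))
    exact .inl (AddSubgroup.disjoint_def.1 (h𝓐.iSupIndep g) hxy hsup)

theorem eq_one_of_isIdempotentElem (h𝓐 : IsGrading 𝓐) {g : G} {a : R} (ha : a ∈ 𝓐 g)
    (hidem : IsIdempotentElem a) (ha0 : a ≠ 0) : g = 1 := by
  have hsq : a ∈ 𝓐 (g * g) := hidem.eq ▸ h𝓐.mul_mem ha ha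
  by_contra hg
  exact ha0 (h𝓐.eq_zero_of_mem_of_mem hsq ha (mt mul_eq_left.1 hg))

end IsGrading

theorem IsStronglyGraded.mul_eq_of_forall_mem (h𝓐 : IsStronglyGraded 𝓐) {p : R} {g : G}
    (hp : ∀ y ∈ 𝓐 g, p * y = y) (z : R) : p * z = z := by
  let fixed : AddSubgroup R := (AddMonoidHom.mulLeft p).eqLocus (AddMonoidHom.id R)
  have component_le (k : G) : 𝓐 k ≤ fixed := by
    rw [← mul_inv_cancel_left g k, ← h𝓐.mul_eq, AddSubgroup.closure_le]
    rintro _ ⟨y, hy, y', -, rfl⟩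
    change p * (y * y') = y * y'
    rw [← mul_assoc, hp y hy]
  have top_le : ⊤ ≤ fixed := h𝓐.iSup_eq_top ▸ iSup_le component_le
  exact top_le (AddSubgroup.mem_top z)

theorem IsGradedClean.exists_inverse (h𝓐 : IsGradedClean 𝓐) {g : G} {x : R} (hx : x ∈ 𝓐 g)
    (hg : g ≠ 1) (hx0 : x ≠ 0) :
    ∃ e : R, (∀ y, e * y = y ∧ y * e = y) ∧ ∃ w, x * w = e ∧ w * x = e := by
  obtain ⟨e, he, hclean⟩ := h𝓐.clean
  obtain ⟨u, a, rfl, ⟨⟨h, hu⟩, hinv⟩, ⟨k, ha⟩, hidem⟩ := hclean x ⟨g, hx⟩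
  have ha0 : a = 0 := by
    by_contra ha0
    obtain rfl : k = 1 := h𝓐.eq_one_of_isIdempotentElem ha hidem ha0
    exact (h𝓐.add_eq_zero_or_right_eq_zero hu ha hx hg.symm).elim hx0 ha0
  exact ⟨e, he, by rwa [ha0, add_zero]⟩

/-- `R` is a crossed product with identity `e`: it is graded, and every homogeneous component
contains a unit. The inverse of a homogeneous unit of degree `g` has degree `g⁻¹`; this is built
into the definition. -/
structure IsCrossedProduct (𝓐 : G → AddSubgroup R) (e : R) : Prop extends IsGrading 𝓐 where
  identity : ∀ x, e * x = x ∧ x * e = x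
  exists_unit : ∀ g, ∃ u ∈ 𝓐 g, ∃ t ∈ 𝓐 g⁻¹, u * t = e ∧ t * u = e

theorem IsGrading.isCrossedProduct_of_closure_eq_top (h𝓐 : IsGrading 𝓐) {e : R}
    (he : ∀ x, e * x = x ∧ x * e = x) (he_mem : e ∈ 𝓐 1) {S : Set G} (hS : Subgroup.closure S = ⊤)
    (hunit : ∀ g ∈ S, ∃ u ∈ 𝓐 g, ∃ t ∈ 𝓐 g⁻¹, u * t = e ∧ t * u = e) : IsCrossedProduct 𝓐 e where
  toIsGrading := h𝓐
  identity := he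
  exists_unit g := by
    have hg : g ∈ Subgroup.closure S := hS ▸ Subgroup.mem_top g
    induction hg using Subgroup.closure_induction with
    | mem g hg => exact hunit g hg
    | one => exact ⟨e, he_mem, e, by rwa [inv_one], (he e).1, (he e).1⟩
    | inv g _ ih =>
      obtain ⟨u, hu, t, ht, hut, htu⟩ := ih
      exact ⟨t, ht, u, by rwa [inv_inv], htu, hut⟩
    | mul g h _ _ ihg ihh =>
      obtain ⟨u, hu, t, ht, hut, htu⟩ := ihg
      obtain ⟨u', hu', t', ht', hut', htu'⟩ := ihh
      refine ⟨u * u', h𝓐.mul_mem hu hu', t' * t, ?_, ?_, ?_⟩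
      · rw [mul_inv_rev]
        exact h𝓐.mul_mem ht' ht
      · rw [mul_assoc, ← mul_assoc u', hut', (he t).1, hut]
      · rw [mul_assoc, ← mul_assoc t, htu, (he u').1, htu']

namespace IsCrossedProduct

variable {e : R}

theorem identity_mem (h𝓐 : IsCrossedProduct 𝓐 e) : e ∈ 𝓐 1 := by
  obtain ⟨u, hu, t, ht, rfl, -⟩ := h𝓐.exists_unit 1
  exact mul_inv_cancel (1 : G) ▸ h𝓐.mul_mem hu ht

theorem isStronglyGraded (h𝓐 : IsCrossedProduct 𝓐 e) : IsStronglyGraded 𝓐 where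
  toIsGrading := h𝓐.toIsGrading
  mul_eq g h := by
    refine le_antisymm ((AddSubgroup.closure_le _).2 ?_) fun z hz => ?_
    · rintro _ ⟨x, hx, y, hy, rfl⟩
      exact h𝓐.mul_mem hx hy
    · obtain ⟨u, hu, t, ht, hut, -⟩ := h𝓐.exists_unit g
      have htz : t * z ∈ 𝓐 h := inv_mul_cancel_left g h ▸ h𝓐.mul_mem ht hz
      exact AddSubgroup.subset_closure
        ⟨u, hu, t * z, htz, by rw [← mul_assoc, hut, (h𝓐.identity z).1]⟩

theorem exists_inverse_of_ne_zero (h𝓐 : IsCrossedProduct 𝓐 e)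
    (hdiv : ∀ r ∈ 𝓐 1, r ≠ 0 → ∃ s, r * s = e ∧ s * r = e) {g : G} {x : R} (hx : x ∈ 𝓐 g)
    (hx0 : x ≠ 0) : ∃ w, x * w = e ∧ w * x = e := by
  obtain ⟨u, -, t, ht, hut, -⟩ := h𝓐.exists_unit g
  have htx : t * x ∈ 𝓐 1 := inv_mul_cancel g ▸ h𝓐.mul_mem ht hx
  have hx_eq : x = u * (t * x) := by rw [← mul_assoc, hut, (h𝓐.identity x).1]
  obtain ⟨s, htxs, hstx⟩ := hdiv _ htx fun h0 => hx0 (by rw [hx_eq, h0, mul_zero])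
  refine ⟨s * t, ?_, by rw [mul_assoc, hstx]⟩
  calc x * (s * t) = u * (t * x * s) * t := by simp only [← mul_assoc, hut, (h𝓐.identity x).1]
    _ = e := by rw [htxs, (h𝓐.identity u).2, hut]

theorem isGradedClean (h𝓐 : IsCrossedProduct 𝓐 e)
    (hdiv : ∀ r ∈ 𝓐 1, r ≠ 0 → ∃ s, r * s = e ∧ s * r = e) : IsGradedClean 𝓐 where
  toIsGrading := h𝓐.toIsGrading
  clean := by
    refine ⟨e, h𝓐.identity, ?_⟩
    rintro x ⟨g, hx⟩
    have hee : e * e = e := (h𝓐.identity e).1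
    rcases eq_or_ne x 0 with rfl | hx0
    · exact ⟨-e, e, (neg_add_cancel e).symm,
        ⟨⟨1, neg_mem h𝓐.identity_mem⟩, -e, by rw [neg_mul_neg, hee], by rw [neg_mul_neg, hee]⟩,
        ⟨1, h𝓐.identity_mem⟩, hee⟩
    · exact ⟨x, 0, (add_zero x).symm, ⟨⟨g, hx⟩, h𝓐.exists_inverse_of_ne_zero hdiv hx hx0⟩,
        ⟨1, zero_mem _⟩, mul_zero 0⟩

end IsCrossedProduct

end Graded

namespace DirGraph

variable {V : Type u} {A : Type v} {K : Type w} [Field K] {E : DirGraph V A}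

theorem vx_mem_grading (x : V) : vx K E x ∈ grading K E 1 := by
  change phi K E _ ∈ component K E _
  rw [phi_vx]
  exact delta_mem_component _ _ _

theorem ed_mem_grading (f : A) : ed K E f ∈ grading K E (FreeGroup.of f) := by
  change phi K E _ ∈ component K E _
  rw [phi_ed]
  exact delta_mem_component _ _ _

theorem gh_mem_grading (f : A) : gh K E f ∈ grading K E (FreeGroup.of f)⁻¹ := by
  change phi K E _ ∈ component K E _
  rw [phi_gh]
  exact delta_mem_component _ _ _

theorem vx_ne_zero (x : V) : vx K E x ≠ 0 := by
  intro hx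
  obtain ⟨ζ, hζ⟩ := exists_boundaryPath E x
  have hdelta : delta K E 1 (oneV K E x) (oneV_mem_D x) = 0 := by rw [← phi_vx, hx, map_zero]
  have hone : oneV K E x = 0 := Finsupp.single_eq_zero.1 (congrArg Subtype.val hdelta)
  exact oneV_apply hζ (congrFun hone ζ)

theorem ed_ne_zero (f : A) : ed K E f ≠ 0 := fun hf =>
  vx_ne_zero (K := K) (E := E) (E.rng f) (by rw [← gh_ed, hf, mul_zero])

theorem ed_mul_gh_mul_ed (f : A) : ed K E f * gh K E f * ed K E f = ed K E f := by
  rw [mul_assoc, gh_ed, ed_vx]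

theorem phi_ed_mul_gh (f : A) :
    (phi K E (ed K E f * gh K E f)).1 = Finsupp.single 1 (oneG K E (FreeGroup.of f)) := by
  rw [map_mul, phi_ed, phi_gh, delta_mul, alpha_oneG, mul_inv_cancel, oneG_one, mul_one,
    oneG_mul_self]

theorem oneG_mul_of_mem_D {g : FreeGroup A} {r : E.BoundaryPath → K} (hr : r ∈ D K E g) :
    oneG K E g * r = r := by
  funext ξ
  by_cases hξ : ξ ∈ E.dom g
  · simp [oneG, hξ]
  · rw [Pi.mul_apply, D_support hr hξ, mul_zero]

theorem ed_mul_gh_mul_of_mem_grading {f : A} {y : LPA K E}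
    (hy : y ∈ grading K E (FreeGroup.of f)) : ed K E f * gh K E f * y = y := by
  have hr : (phi K E y).1 (FreeGroup.of f) ∈ D K E (FreeGroup.of f) := (phi K E y).2 _
  have hphi : (phi K E y).1 =
      Finsupp.single (FreeGroup.of f) ((phi K E y).1 (FreeGroup.of f)) :=
    congrArg Subtype.val (component_eq hy)
  refine phi_injective (Subtype.ext ?_)
  rw [map_mul, skew_coe_mul, phi_ed_mul_gh, hphi, skewMul_single, one_mul, inv_one, alpha_one,
    alpha_one, oneG_mul_of_mem_D hr]

theorem subsingleton_of_isLoop (h : E.IsLoop) : Subsingleton V ∧ Subsingleton A := by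
  obtain ⟨x, f, -, -, hV, hA⟩ := h
  exact ⟨subsingleton_of_forall_eq x hV, subsingleton_of_forall_eq f hA⟩

theorem isLoop_of_forall_ed_mul_gh_mul {f : A} (hf : ∀ z, ed K E f * gh K E f * z = z) :
    E.IsLoop := by
  have eq_src (x : V) : x = E.src f := by
    by_contra hne
    refine vx_ne_zero (K := K) (E := E) x ?_
    rw [← hf (vx K E x), mul_assoc, gh_vx_ne (Ne.symm hne), mul_zero]
  have eq_edge (f' : A) : f' = f := by
    by_contra hne
    refine ed_ne_zero (K := K) (E := E) f' ?_
    rw [← hf (ed K E f'), mul_assoc, gh_ed_ne (Ne.symm hne), mul_zero]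
  exact ⟨E.src f, f, rfl, eq_src _, eq_src, eq_edge⟩

theorem isLoop_of_isStronglyGraded [Nonempty A] (h : IsStronglyGraded (grading K E)) :
    E.IsLoop := by
  obtain ⟨f⟩ := ‹Nonempty A›
  exact isLoop_of_forall_ed_mul_gh_mul
    (h.mul_eq_of_forall_mem fun _ hy => ed_mul_gh_mul_of_mem_grading (f := f) hy)

theorem isLoop_of_isGradedClean [Nonempty A] (h : IsGradedClean (grading K E)) : E.IsLoop := by
  obtain ⟨f⟩ := ‹Nonempty A›
  obtain ⟨e, he, w, hfw, -⟩ :=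
    h.exists_inverse (ed_mem_grading f) (FreeGroup.of_ne_one f) (ed_ne_zero f)
  have h_one : ed K E f * gh K E f = e := by
    rw [← (he (ed K E f * gh K E f)).2, ← hfw, ← mul_assoc, ed_mul_gh_mul_ed]
  exact isLoop_of_forall_ed_mul_gh_mul (f := f) fun z => by rw [h_one, (he z).1]

theorem vx_identity [Subsingleton V] (x : V) (y : LPA K E) :
    vx K E x * y = y ∧ y * vx K E x = y := by
  induction y using LPA.induction with
  | hv y => rw [Subsingleton.elim y x]; exact ⟨vx_mul_self x, vx_mul_self x⟩
  | he f =>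
    exact ⟨Subsingleton.elim (E.src f) x ▸ vx_ed f, Subsingleton.elim (E.rng f) x ▸ ed_vx f⟩
  | hg f =>
    exact ⟨Subsingleton.elim (E.rng f) x ▸ vx_gh f, Subsingleton.elim (E.src f) x ▸ gh_vx f⟩
  | h0 => exact ⟨mul_zero _, zero_mul _⟩
  | hadd y z hy hz => rw [mul_add, add_mul, hy.1, hy.2, hz.1, hz.2]; exact ⟨rfl, rfl⟩
  | hsmul c y hy => rw [mul_smul_comm, smul_mul_assoc, hy.1, hy.2]; exact ⟨rfl, rfl⟩
  | hmul y z hy hz => rw [← mul_assoc, hy.1, mul_assoc, hz.2]; exact ⟨rfl, rfl⟩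

theorem ed_mul_gh_of_forall_src_eq {f : A} (hf : ∀ f', E.src f' = E.src f → f' = f) :
    ed K E f * gh K E f = vx K E (E.src f) := by
  have hset : {f' | E.src f' = E.src f} = {f} :=
    Set.ext fun f' => ⟨hf f', fun h => congrArg E.src h⟩
  have hfin : {f' | E.src f' = E.src f}.Finite := hset ▸ Set.finite_singleton f
  have htoFinset : hfin.toFinset = {f} := by
    simp only [hset, Set.toFinite_toFinset, Set.toFinset_singleton]
  rw [vx_eq_sum _ hfin ⟨f, rfl⟩, htoFinset, Finset.sum_singleton]

theorem isCrossedProduct_grading [Subsingleton V] [Subsingleton A] (x : V) :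
    IsCrossedProduct (grading K E) (vx K E x) := by
  refine (grading_isGrading K E).isCrossedProduct_of_closure_eq_top (vx_identity x)
    (vx_mem_grading x) (FreeGroup.closure_range_of A) ?_
  rintro _ ⟨f, rfl⟩
  refine ⟨ed K E f, ed_mem_grading f, gh K E f, gh_mem_grading f, ?_, ?_⟩
  · rw [ed_mul_gh_of_forall_src_eq fun _ _ => Subsingleton.elim _ _, Subsingleton.elim (E.src f) x]
  · rw [gh_ed, Subsingleton.elim (E.rng f) x]

theorem subsingleton_boundaryPath [Subsingleton V] [Subsingleton A] :
    Subsingleton E.BoundaryPath := by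
  refine ⟨fun ξ η => ?_⟩
  have edge_ne_none (ζ : E.BoundaryPath) (n : ℕ) (f : A) : ζ.edge n ≠ none := fun hn =>
    (ζ.sink_end n hn).1 f (Subsingleton.elim _ _)
  ext1
  · exact Subsingleton.elim _ _
  · funext n
    cases hξ : ξ.edge n with
    | none =>
      cases hη : η.edge n with
      | none => rfl
      | some f => exact absurd hξ (edge_ne_none ξ n f)
    | some f =>
      cases hη : η.edge n with
      | none => exact absurd hη (edge_ne_none η n f)
      | some f' => rw [Subsingleton.elim f f']

theorem exists_eq_smul_vx_of_mem_grading_one [Subsingleton E.BoundaryPath] (x : V) {y : LPA K E}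
    (hy : y ∈ grading K E 1) : ∃ c : K, y = c • vx K E x := by
  obtain ⟨ζ, hζ⟩ := exists_boundaryPath E x
  refine ⟨(phi K E y).1 1 ζ, phi_injective (Subtype.ext (Finsupp.ext fun g => ?_))⟩
  rw [map_smul, Submodule.coe_smul, Finsupp.smul_apply]
  rcases eq_or_ne g 1 with rfl | hg
  · funext ξ
    have hvx : (phi K E (vx K E x)).1 1 = oneV K E x := by
      rw [phi_vx]
      exact Finsupp.single_eq_same
    rw [Subsingleton.elim ξ ζ, hvx]
    simp [oneV, hζ]
  · rw [mem_grading.1 hy g hg, mem_grading.1 (vx_mem_grading x) g hg, smul_zero]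

theorem exists_inverse_of_mem_grading_one [Subsingleton E.BoundaryPath] (x : V) {y : LPA K E}
    (hy : y ∈ grading K E 1) (hy0 : y ≠ 0) : ∃ z, y * z = vx K E x ∧ z * y = vx K E x := by
  obtain ⟨c, rfl⟩ := exists_eq_smul_vx_of_mem_grading_one x hy
  have hc : c ≠ 0 := fun hc => hy0 (by rw [hc, zero_smul])
  refine ⟨c⁻¹ • vx K E x, ?_, ?_⟩
  · rw [smul_mul_smul_comm, mul_inv_cancel₀ hc, one_smul, vx_mul_self]
  · rw [smul_mul_smul_comm, inv_mul_cancel₀ hc, one_smul, vx_mul_self]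

theorem isStronglyGraded_grading_iff [Nonempty A] : IsStronglyGraded (grading K E) ↔ E.IsLoop := by
  refine ⟨isLoop_of_isStronglyGraded, fun h => ?_⟩
  obtain ⟨_, _⟩ := subsingleton_of_isLoop h
  obtain ⟨x, -⟩ := h
  exact (isCrossedProduct_grading x).isStronglyGraded

theorem isGradedClean_grading_iff [Nonempty A] : IsGradedClean (grading K E) ↔ E.IsLoop := by
  refine ⟨isLoop_of_isGradedClean, fun h => ?_⟩
  obtain ⟨_, _⟩ := subsingleton_of_isLoop h
  have := subsingleton_boundaryPath (E := E)
  obtain ⟨x, -⟩ := h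
  exact (isCrossedProduct_grading x).isGradedClean fun _ hy hy0 =>
    exists_inverse_of_mem_grading_one x hy hy0

end DirGraph

theorem proposition3p4 {V : Type*} {A : Type*} {K : Type*} [Field K] (E : DirGraph V A)
    [Nonempty A] :
    (IsGradedClean (DirGraph.grading K E) ↔ IsStronglyGraded (DirGraph.grading K E)) ∧
      (IsStronglyGraded (DirGraph.grading K E) ↔ E.IsLoop) :=
  ⟨DirGraph.isGradedClean_grading_iff.trans DirGraph.isStronglyGraded_grading_iff.symm,
    DirGraph.isStronglyGraded_grading_iff⟩
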